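/- Let $\mathcal H$ be a finite-dimensional complex Hilbert space, $\mathcal H_E\subseteq\mathcal H$ a nonzero subspace of dimension $d_E$ with orthogonal projection $\Pi_E$, and $\Omega_E=\Pi_E/d_E$ the maximally mixed state of $\mathcal H_E$. Let $\mathcal A$ be a finite nonempty set of measurements, each of them a POVM $A=(M_a)_a$ on $\mathcal H$ with a finite number $N(A)$ of outcomes (that is, $M_a\ge 0$ and $\sum_a M_a=\mathbb I$), and let $N(\mathcal A)=\sum_{A\in\mathcal A}N(A)$ be the total number of outcomes of all the measurements in $\mathcal A$. For operators $\rho,\sigma$ on $\mathcal H$ put $$D_A(\rho,\sigma)=\tfrac12\sum_a\bigl|\operatorname{tr}(M_a\rho)-\operatorname{tr}(M_a\sigma)\bigr|,\qquad D_{\mathcal A}(\rho,\sigma)=\max_{A\in\mathcal A}D_A(\rho,\sigma).$$ Let $|\psi\rangle$ be uniformly distributed on the unit sphere of $\mathcal H_E$, let $\psi=|\psi\rangle\langle\psi|$, and let $c=1/(18\pi^3)$. (1) For every $\epsilon>0$, $$\mathrm{Prob}\Bigl(D_{\mathcal A}(\psi,\Omega_E)>\epsilon+\frac{N(\mathcal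 A)}{2\sqrt{d_E}}\Bigr)\le e^{-c\,\epsilon^2 d_E}.$$ (2) Let $H$ be a self-adjoint operator (the Hamiltonian) on $\mathcal H$ that maps $\mathcal H_E$ into itself (for example, let $\mathcal H_E$ be spanned by the eigenvectors of $H$ with energies in an interval $[E-\delta E,E+\delta E]$), and let $\psi(t)=|\psi(t)\rangle\langle\psi(t)|$ with $|\psi(t)\rangle=e^{-iHt}|\psi\rangle$. Then the infinite-time average $$\langle D_{\mathcal A}(\psi(t),\Omega_E)\rangle_t=\lim_{T\to\infty}\frac1T\int_0^T D_{\mathcal A}(\psi(t),\Omega_E)\,dt$$ exists for every unit vector $|\psi\rangle\in\mathcal H_E$, and for every $\epsilon>0$, $$\mathrm{Prob}\Bigl(\langle D_{\mathcal A}(\psi(t),\Omega_E)\rangle_t>\epsilon+\frac{N(\mathcal A)}{2\sqrt{d_E}}\Bigr)\le e^{-c\,\epsilon^2 d_E}.$$ -/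

import Mathlib

open MeasureTheory Filter Topology
open scoped ENNReal

/-- A POVM (generalised measurement) with finitely many outcomes on a finite-dimensional Hilbert
space: positive operators `M_a`, one for each outcome `a`, that sum to the identity. -/
structure POVM (H : Type*) [NormedAddCommGroup H] [InnerProductSpace ℂ H] where
  /-- the number of outcomes of the measurement -/
  numOutcomes : ℕ
  /-- the POVM elements `M_a` -/
  effect : Fin numOutcomes → (H →L[ℂ] H)
  isPositive : ∀ a, (effect a).IsPositive
  sum_eq_one : ∑ a, effect a = 1

namespace QState

variable {H : Type*} [NormedAddCommGroup H] [InnerProductSpace ℂ H] [FiniteDimensional ℂ H]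

/-- The trace of an operator on the finite-dimensional Hilbert space `H`. -/
noncomputable def tr (T : H →L[ℂ] H) : ℂ := LinearMap.trace ℂ H (T : H →ₗ[ℂ] H)

/-- The distinguishability of `ρ` and `σ` by one measurement:
`D_A(ρ,σ) = (1/2) ∑_a |tr(M_a ρ) - tr(M_a σ)|`. -/
noncomputable def distinguish (A : POVM H) (ρ σ : H →L[ℂ] H) : ℝ :=
  (1 / 2) * ∑ a, ‖tr (A.effect a * ρ) - tr (A.effect a * σ)‖

/-- The distinguishability of `ρ` and `σ` by a finite nonempty set of measurements:
`D_𝒜(ρ,σ) = max_{A ∈ 𝒜} D_A(ρ,σ)`. -/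
noncomputable def distinguishSet (𝒜 : Finset (POVM H)) (h : 𝒜.Nonempty) (ρ σ : H →L[ℂ] H) : ℝ :=
  𝒜.sup' h (fun A => distinguish A ρ σ)

/-- `N(𝒜)`: the total number of outcomes of all the measurements in `𝒜`. -/
def totalOutcomes (𝒜 : Finset (POVM H)) : ℕ := ∑ A ∈ 𝒜, A.numOutcomes

/-- The rank-one operator `|v⟩⟨v|`. -/
noncomputable def pureState (v : H) : H →L[ℂ] H := InnerProductSpace.rankOne ℂ v v

/-- The maximally mixed state `Ω = Π / d` of the subspace `K`, where `Π` is the orthogonal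
projection of `H` onto `K` and `d = dim K`. -/
noncomputable def maxMixed (K : Submodule ℂ H) : H →L[ℂ] H :=
  ((Module.finrank ℂ K : ℂ)⁻¹) • K.starProjection

/-- The unitary time evolution `exp(-i t Ham)` (with `ℏ = 1`). -/
noncomputable def evolution (Ham : H →L[ℂ] H) (t : ℝ) : H →L[ℂ] H :=
  NormedSpace.exp ((-(Complex.I * (t : ℂ))) • Ham)

/-- The finite-time average `(1/T) ∫_0^T f(t) dt`. -/
noncomputable def averageUpTo (f : ℝ → ℝ) (T : ℝ) : ℝ := T⁻¹ * ∫ t in (0 : ℝ)..T, f t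

/-- The infinite-time average `lim_{T → ∞} (1/T) ∫_0^T f(t) dt` (meaningful when the limit
exists). -/
noncomputable def timeAverage (f : ℝ → ℝ) : ℝ := limUnder atTop (averageUpTo f)

/-- The uniform (unitarily invariant) probability measure on the unit sphere of the subspace `K`:
the surface measure induced by Lebesgue (additive Haar) measure on `K`, normalised to mass one. -/
noncomputable def uniformSphere [MeasurableSpace H] [BorelSpace H] (K : Submodule ℂ H) :
    Measure (Metric.sphere (0 : K) 1) :=
  ((Measure.addHaar : Measure K).toSphere Set.univ)⁻¹ • (Measure.addHaar : Measure K).toSphere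

end QState

/-!
The proof combines Lévy's lemma on the sphere of `K` with a bound on the mean of the
distinguishability.

*Concentration.* Lévy's lemma (`levy_lemma`) is derived from Gaussian concentration. If `x`, `y` are
independent standard Gaussian vectors and `G` is `Λ`-Lipschitz, then `G y - G x` is a sum of many
increments along small rotations of the pair `(x, y)`. The law of the pair is rotation invariant, so
convexity of `exp` bounds the exponential moment by that of a single rescaled increment. In the limit
the increment becomes `π / 2` times the derivative of `G` at `x` in the independent direction `y`
(Rademacher's theorem), which is Gaussian; this is the Maurey–Pisier inequality
`integral_exp_sub_le`. A centred 1-Lipschitz function on the sphere is extended 1-homogeneously to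
the Gaussian space. In polar coordinates the radius is independent of the direction, and Jensen's
inequality replaces it by its mean, which is at least `√n / 5`. Since exponential moments are bounded
without a prefactor, so is the tail, and the resulting constant suffices for `1 / (36 π³)` per real
dimension.

*Lipschitz constant.* On unit vectors the distinguishability is 1-Lipschitz: by polarisation
`⟨x, M x⟩ - ⟨y, M y⟩ = Re ⟨x - y, M (x + y)⟩`, and a Cauchy–Schwarz inequality for the whole POVM
(`POVM.sum_abs_re_inner_le`) bounds the sum over the outcomes by `2 ‖x - y‖`.

*Mean.* The maximum over the measurements is at most the sum over all outcomes of half of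
`|⟨ψ, M ψ⟩ - tr (M Ω)|`. Diagonalising the compression of `M` to `K`, the fourth moments of the
coordinates of a uniform unit vector, which follow from unitary invariance alone, give a variance of
at most `1 / d` (`IsUnitarilyInvariant.integral_abs_sub_le`).

*Time averages.* In the energy eigenbasis the evolved vector is a continuous function of a
one-parameter subgroup of a torus, and continuous functions on the torus are uniform limits of
trigonometric polynomials, so the time average exists. It inherits the Lipschitz constant, because the
evolution is isometric, and the mean, because the evolution preserves the uniform measure on the sphere
of the invariant subspace `K`.
-/

/-! ### The Gaussian measure of a Euclidean space -/

section Gaussian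

open scoped RealInnerProductSpace

variable {E : Type*} [NormedAddCommGroup E] [InnerProductSpace ℝ E]

/-- The rotation `(x, y) ↦ (cos θ x + sin θ y, cos θ y - sin θ x)` of `E × E`. -/
noncomputable def pairRotation (E : Type*) [NormedAddCommGroup E] [InnerProductSpace ℝ E] (θ : ℝ) :
    (E × E) ≃L[ℝ] (E × E) :=
  ContinuousLinearEquiv.equivOfInverse
    ((Real.cos θ • ContinuousLinearMap.fst ℝ E E + Real.sin θ • ContinuousLinearMap.snd ℝ E E).prod
      (Real.cos θ • ContinuousLinearMap.snd ℝ E E - Real.sin θ • ContinuousLinearMap.fst ℝ E E))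
    ((Real.cos θ • ContinuousLinearMap.fst ℝ E E - Real.sin θ • ContinuousLinearMap.snd ℝ E E).prod
      (Real.cos θ • ContinuousLinearMap.snd ℝ E E + Real.sin θ • ContinuousLinearMap.fst ℝ E E))
    (by
      rintro ⟨x, y⟩
      have h := Real.sin_sq_add_cos_sq θ
      ext <;> simp <;> match_scalars <;> linarith)
    (by
      rintro ⟨x, y⟩
      have h := Real.sin_sq_add_cos_sq θ
      ext <;> simp <;> match_scalars <;> linarith)

theorem pairRotation_apply (θ : ℝ) (p : E × E) :
    pairRotation E θ p = (Real.cos θ • p.1 + Real.sin θ • p.2,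
      Real.cos θ • p.2 - Real.sin θ • p.1) := rfl

variable [FiniteDimensional ℝ E] [MeasurableSpace E] [BorelSpace E] (μ : Measure E) [μ.IsAddHaarMeasure]

/-- The standard Gaussian probability measure of a Euclidean space, written as the density
proportional to `exp (-‖x‖² / 2)` with respect to a Haar measure `μ` (it does not depend on `μ`). -/
noncomputable def gaussianOf (μ : Measure E) : Measure E := μ.tilted fun x => -‖x‖ ^ 2 / 2

theorem integrable_exp_neg_mul_norm_sq {b : ℝ} (hb : 0 < b) :
    Integrable (fun x : E => Real.exp (-b * ‖x‖ ^ 2)) μ := by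
  have h := (GaussianFourier.integrable_cexp_neg_mul_sq_norm_add (V := E) (b := (b : ℂ))
    (by simpa using hb) 0 0).norm
  have h2 : Integrable (fun x : E => Real.exp (-b * ‖x‖ ^ 2)) volume := by
    refine h.congr (Eventually.of_forall fun x => ?_)
    simp only [Complex.norm_exp]
    congr 1
    simp [← Complex.ofReal_pow]
  rw [Measure.isAddLeftInvariant_eq_smul μ (volume : Measure E)]
  exact h2.smul_measure ENNReal.coe_ne_top

theorem integrable_gaussian_density :
    Integrable (fun x : E => Real.exp (-‖x‖ ^ 2 / 2)) μ := by
  refine (integrable_exp_neg_mul_norm_sq μ (b := 1 / 2) (by norm_num)).congr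
    (Eventually.of_forall fun x => ?_)
  simp only
  congr 1
  ring

instance isProbabilityMeasure_gaussianOf : IsProbabilityMeasure (gaussianOf μ) :=
  isProbabilityMeasure_tilted (integrable_gaussian_density μ)

theorem integrable_exp_mul_norm_gaussianOf (a : ℝ) :
    Integrable (fun x : E => Real.exp (a * ‖x‖)) (gaussianOf μ) := by
  unfold gaussianOf
  rw [integrable_tilted_iff (integrable_gaussian_density μ)]
  refine ((integrable_exp_neg_mul_norm_sq μ (b := 1 / 4) (by norm_num)).const_mul
    (Real.exp (a ^ 2))).mono' (by fun_prop) (Eventually.of_forall fun x => ?_)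
  rw [smul_eq_mul, ← Real.exp_add, ← Real.exp_add, Real.norm_eq_abs, Real.abs_exp]
  apply Real.exp_le_exp.2
  nlinarith [sq_nonneg (‖x‖ / 2 - a)]

theorem integrable_norm_gaussianOf : Integrable (fun x : E => ‖x‖) (gaussianOf μ) := by
  refine (integrable_exp_mul_norm_gaussianOf μ 1).mono' (by fun_prop)
    (Eventually.of_forall fun x => ?_)
  rw [norm_norm, one_mul]
  linarith [Real.add_one_le_exp ‖x‖]

/-- The Laplace transform of a linear functional, by completing the square. -/
theorem integral_exp_inner_gaussianOf (v : E) :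
    ∫ y, Real.exp ⟪v, y⟫ ∂gaussianOf μ = Real.exp (‖v‖ ^ 2 / 2) := by
  unfold gaussianOf
  rw [integral_exp_tilted]
  have h : ∀ y : E, Real.exp ((((fun x => -‖x‖ ^ 2 / 2) + fun y => ⟪v, y⟫) : E → ℝ) y)
      = Real.exp (‖v‖ ^ 2 / 2) * Real.exp (-‖y - v‖ ^ 2 / 2) := by
    intro y
    rw [← Real.exp_add]
    congr 1
    rw [norm_sub_sq_real, real_inner_comm v y]
    simp only [Pi.add_apply]
    ring
  simp_rw [h]
  rw [integral_const_mul, integral_sub_right_eq_self (fun y : E => Real.exp (-‖y‖ ^ 2 / 2)) v,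
    mul_div_assoc, div_self, mul_one]
  exact (integral_exp_pos (integrable_gaussian_density μ)).ne'

/-- A probability measure whose density with respect to a Haar measure is invariant under a linear
automorphism is itself invariant: the automorphism rescales Haar measure by a constant, and this
constant is one because the total mass is preserved. -/
theorem map_withDensity_eq_self_of_comp_eq {F : Type*} [NormedAddCommGroup F] [NormedSpace ℝ F]
    [FiniteDimensional ℝ F] [MeasurableSpace F] [BorelSpace F] (ν : Measure F) [ν.IsAddHaarMeasure]
    (w : F → ℝ≥0∞) [IsProbabilityMeasure (ν.withDensity w)]
    (L : F ≃L[ℝ] F) (hL : ∀ x, w (L x) = w x) :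
    (ν.withDensity w).map L = ν.withDensity w := by
  obtain ⟨c, hc⟩ : ∃ c : ℝ≥0∞, ν.map L = c • ν :=
    ⟨_, Measure.map_linearMap_addHaar_eq_smul_addHaar ν (f := (L : F →ₗ[ℝ] F))
      (LinearEquiv.isUnit_det' L.toLinearEquiv).ne_zero⟩
  have hemb : MeasurableEmbedding L := L.toHomeomorph.measurableEmbedding
  have key : (ν.withDensity w).map L = c • ν.withDensity w := by
    ext s hs
    rw [Measure.map_apply hemb.measurable hs, withDensity_apply _ (hemb.measurable hs),
      Measure.smul_apply, withDensity_apply _ hs, smul_eq_mul, ← smul_eq_mul,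
      ← lintegral_smul_measure, ← Measure.restrict_smul, ← hc, hemb.restrict_map,
      hemb.lintegral_map]
    simp_rw [hL]
  have h1 : (ν.withDensity w).map L Set.univ = 1 := by
    rw [Measure.map_apply hemb.measurable MeasurableSet.univ]
    simp
  rw [key] at h1
  have hc1 : c = 1 := by simpa using h1
  rw [key, hc1, one_smul]

theorem map_gaussianOf_isometry (U : E ≃ₗᵢ[ℝ] E) : (gaussianOf μ).map U = gaussianOf μ := by
  have : IsProbabilityMeasure (μ.withDensity fun x =>
      ENNReal.ofReal (Real.exp (-‖x‖ ^ 2 / 2) / ∫ x, Real.exp (-‖x‖ ^ 2 / 2) ∂μ)) :=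
    isProbabilityMeasure_gaussianOf μ
  exact map_withDensity_eq_self_of_comp_eq μ (fun x =>
      ENNReal.ofReal (Real.exp (-‖x‖ ^ 2 / 2) / ∫ x, Real.exp (-‖x‖ ^ 2 / 2) ∂μ))
    U.toContinuousLinearEquiv fun x => by simp

/-- Two independent standard Gaussian vectors are jointly rotation invariant. -/
theorem map_pairRotation_gaussianOf_prod (θ : ℝ) :
    ((gaussianOf μ).prod (gaussianOf μ)).map (pairRotation E θ)
      = (gaussianOf μ).prod (gaussianOf μ) := by
  set w : E → ℝ≥0∞ := fun x =>
    ENNReal.ofReal (Real.exp (-‖x‖ ^ 2 / 2) / ∫ x, Real.exp (-‖x‖ ^ 2 / 2) ∂μ) with hw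
  have hprod : (gaussianOf μ).prod (gaussianOf μ)
      = (μ.prod μ).withDensity fun z => w z.1 * w z.2 :=
    prod_withDensity (by fun_prop) (by fun_prop)
  have : IsProbabilityMeasure ((μ.prod μ).withDensity fun z : E × E => w z.1 * w z.2) := by
    rw [← hprod]; infer_instance
  rw [hprod]
  refine map_withDensity_eq_self_of_comp_eq _ _ _ fun p => ?_
  have hZ : 0 ≤ ∫ x, Real.exp (-‖x‖ ^ 2 / 2) ∂μ := integral_nonneg fun x => (Real.exp_pos _).le
  simp only [hw, pairRotation_apply]
  rw [← ENNReal.ofReal_mul (by positivity), ← ENNReal.ofReal_mul (by positivity),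
    div_mul_div_comm, div_mul_div_comm, ← Real.exp_add, ← Real.exp_add]
  congr 3
  rw [norm_add_sq_real, norm_sub_sq_real]
  simp only [norm_smul, inner_smul_left, inner_smul_right, mul_pow, Real.norm_eq_abs, sq_abs]
  rw [real_inner_comm p.1 p.2]
  simp only [conj_trivial]
  linear_combination (-(‖p.1‖ ^ 2 + ‖p.2‖ ^ 2) / 2) * Real.sin_sq_add_cos_sq θ

/-- A lower bound `√n / 5` for the mean norm of a Gaussian vector in dimension `n ≥ 2`, from
`r ≥ (√n / 2) (1 - exp (3/2 (n/4 - r²)))` and `E exp (-3/2 ‖x‖²) = 2⁻ⁿ`. -/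
theorem le_integral_norm_gaussianOf (hn : 2 ≤ Module.finrank ℝ E) :
    √(Module.finrank ℝ E) / 5 ≤ ∫ x, ‖x‖ ∂gaussianOf μ := by
  set n := Module.finrank ℝ E with hndef
  have hI : ∫ x : E, Real.exp (-(3 / 2) * ‖x‖ ^ 2) ∂gaussianOf μ = ((2 : ℝ) ^ n)⁻¹ := by
    unfold gaussianOf
    rw [integral_exp_tilted]
    have h : ∀ x : E, Real.exp ((((fun x => -‖x‖ ^ 2 / 2) + fun x => -(3 / 2) * ‖x‖ ^ 2) : E → ℝ) x)
        = Real.exp (-‖(2 : ℝ) • x‖ ^ 2 / 2) := by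
      intro x
      congr 1
      simp only [Pi.add_apply, norm_smul, Real.norm_ofNat]
      ring
    simp_rw [h]
    rw [Measure.integral_comp_smul_of_nonneg μ (fun x : E => Real.exp (-‖x‖ ^ 2 / 2)) 2
      (hR := by norm_num), smul_eq_mul, mul_div_assoc, div_self, mul_one]
    exact (integral_exp_pos (integrable_gaussian_density μ)).ne'
  have hint : Integrable (fun x : E => Real.exp (-(3 / 2) * ‖x‖ ^ 2)) (gaussianOf μ) := by
    refine (integrable_const (1 : ℝ)).mono' (by fun_prop) (Eventually.of_forall fun x => ?_)
    rw [Real.norm_eq_abs, Real.abs_exp, Real.exp_le_one_iff]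
    nlinarith [sq_nonneg ‖x‖]
  have hpt : ∀ x : E, √n / 2 * (1 - Real.exp (3 / 8 * n) * Real.exp (-(3 / 2) * ‖x‖ ^ 2)) ≤ ‖x‖ := by
    intro x
    rw [← Real.exp_add]
    have hs : √(n : ℝ) ^ 2 = n := Real.sq_sqrt (Nat.cast_nonneg n)
    have hs0 : 0 ≤ √(n : ℝ) := Real.sqrt_nonneg _
    rcases le_total (√(n : ℝ) / 2) ‖x‖ with h | h
    · have := Real.exp_pos (3 / 8 * n + -(3 / 2) * ‖x‖ ^ 2)
      nlinarith
    · have h1 : 0 ≤ 3 / 8 * (n : ℝ) + -(3 / 2) * ‖x‖ ^ 2 := by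
        nlinarith [norm_nonneg x]
      have h2 := Real.one_le_exp h1
      nlinarith [norm_nonneg x]
  have hmono := integral_mono (μ := gaussianOf μ)
    (((integrable_const (1 : ℝ)).sub (hint.const_mul (Real.exp (3 / 8 * n)))).const_mul (√n / 2))
    (integrable_norm_gaussianOf μ) hpt
  refine le_trans ?_ hmono
  simp only [Pi.sub_apply]
  rw [integral_const_mul, integral_sub (integrable_const _) (hint.const_mul _), integral_const_mul,
    hI]
  simp only [integral_const, probReal_univ, smul_eq_mul, mul_one]
  -- the base `e^{3/8} / 2` is less than one, so the worst case is `n = 2`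
  have hq : Real.exp (3 / 8 * n) * ((2 : ℝ) ^ n)⁻¹ = (Real.exp (3 / 8) / 2) ^ n := by
    rw [div_pow, ← Real.exp_nat_mul, div_eq_mul_inv]
    ring_nf
  have he : (Real.exp (3 / 8) / 2) ^ 2 ≤ 3 / 5 := by
    have h3 : (Real.exp (3 / 8) ^ 2) ^ 4 ≤ (12 / 5) ^ 4 := by
      rw [← pow_mul, ← Real.exp_nat_mul]
      have : Real.exp ((2 * 4 : ℕ) * (3 / 8)) = Real.exp 1 ^ 3 := by
        rw [← Real.exp_nat_mul]; norm_num
      rw [this]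
      calc Real.exp 1 ^ 3 ≤ 2.72 ^ 3 := by
            gcongr
            exact Real.exp_one_lt_d9.le.trans (by norm_num)
        _ ≤ _ := by norm_num
    have := le_of_pow_le_pow_left₀ (by norm_num) (by norm_num) h3
    rw [div_pow]
    linarith
  have he0 : 0 ≤ Real.exp (3 / 8) / 2 := by positivity
  have he1 : Real.exp (3 / 8) / 2 ≤ 1 := by nlinarith
  have hfin : (Real.exp (3 / 8) / 2) ^ n ≤ 3 / 5 :=
    (pow_le_pow_of_le_one he0 he1 hn).trans he
  rw [hq]
  nlinarith [Real.sqrt_nonneg (n : ℝ)]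

end Gaussian

/-! ### Gaussian concentration for Lipschitz functions -/

section MaureyPisier

open scoped RealInnerProductSpace NNReal

variable {E : Type*} [NormedAddCommGroup E] [InnerProductSpace ℝ E]

theorem pairRotation_add_fst (θ δ : ℝ) (p : E × E) :
    (pairRotation E (θ + δ) p).1 = (pairRotation E δ (pairRotation E θ p)).1 := by
  simp only [pairRotation_apply, Real.cos_add, Real.sin_add]
  module

/-- Rotating `(x, y)` by the angle `π / (2 (k + 1))` moves the first component by
`O((‖x‖ + ‖y‖) / (k + 1))`. -/
theorem mul_norm_pairRotation_sub_le (k : ℕ) (p : E × E) :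
    (k + 1 : ℝ) * ‖(pairRotation E (Real.pi / (2 * (k + 1))) p).1 - p.1‖
      ≤ 2 * (‖p.1‖ + ‖p.2‖) := by
  set δ : ℝ := Real.pi / (2 * (k + 1)) with hδ
  have hk : (0 : ℝ) < k + 1 := by positivity
  have hδ0 : 0 ≤ δ := by positivity
  have hkδ : (k + 1 : ℝ) * δ = Real.pi / 2 := by rw [hδ]; field_simp
  have hδ2 : δ ≤ 2 := by
    have : δ ≤ (k + 1 : ℝ) * δ := by nlinarith [Nat.cast_nonneg (α := ℝ) k]
    linarith [Real.pi_lt_four]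
  have hcos : |Real.cos δ - 1| ≤ δ := by
    rw [abs_le]
    constructor
    · nlinarith [Real.one_sub_sq_div_two_le_cos (x := δ)]
    · linarith [Real.cos_le_one δ]
  have hsin : |Real.sin δ| ≤ δ := (Real.abs_sin_le_abs).trans (abs_of_nonneg hδ0).le
  have h1 : (pairRotation E δ p).1 - p.1 = (Real.cos δ - 1) • p.1 + Real.sin δ • p.2 := by
    simp only [pairRotation_apply]
    module
  have h2 : ‖(pairRotation E δ p).1 - p.1‖ ≤ δ * (‖p.1‖ + ‖p.2‖) := by
    rw [h1]
    refine (norm_add_le _ _).trans ?_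
    rw [norm_smul, norm_smul, Real.norm_eq_abs, Real.norm_eq_abs, mul_add]
    gcongr
  calc (k + 1 : ℝ) * ‖(pairRotation E δ p).1 - p.1‖
      ≤ (k + 1 : ℝ) * (δ * (‖p.1‖ + ‖p.2‖)) := by gcongr
    _ = Real.pi / 2 * (‖p.1‖ + ‖p.2‖) := by rw [← mul_assoc, hkδ]
    _ ≤ 2 * (‖p.1‖ + ‖p.2‖) := by
      gcongr
      linarith [Real.pi_lt_four]

/-- The rescaled increment of `G` along a rotation by a small angle is dominated by a function that
does not depend on the angle. -/
theorem exp_increment_le {G : E → ℝ} {Λ : ℝ≥0} (hG : LipschitzWith Λ G) (k : ℕ) (p : E × E) :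
    Real.exp ((k + 1 : ℝ) * (G (pairRotation E (Real.pi / (2 * (k + 1))) p).1 - G p.1))
      ≤ Real.exp (2 * Λ * ‖p.1‖) * Real.exp (2 * Λ * ‖p.2‖) := by
  rw [← Real.exp_add]
  apply Real.exp_le_exp.2
  have h1 := (le_abs_self _).trans (hG.norm_sub_le (pairRotation E (Real.pi / (2 * (k + 1))) p).1 p.1)
  have h2 := mul_norm_pairRotation_sub_le k p
  calc _ ≤ (k + 1 : ℝ) * (Λ * ‖(pairRotation E (Real.pi / (2 * (k + 1))) p).1 - p.1‖) := by gcongr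
    _ = Λ * ((k + 1 : ℝ) * ‖(pairRotation E (Real.pi / (2 * (k + 1))) p).1 - p.1‖) := by ring
    _ ≤ Λ * (2 * (‖p.1‖ + ‖p.2‖)) := by gcongr
    _ = _ := by ring

/-- As the rotation angle tends to zero, the rescaled increment of `G` tends to a directional
derivative. -/
theorem tendsto_rescaled_increment {G : E → ℝ} (p : E × E) (hd : DifferentiableAt ℝ G p.1) :
    Tendsto (fun k : ℕ =>
      (k + 1 : ℝ) * (G (pairRotation E (Real.pi / (2 * (k + 1))) p).1 - G p.1)) atTop
      (𝓝 (Real.pi / 2 * fderiv ℝ G p.1 p.2)) := by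
  have hcurve : HasDerivAt (fun t : ℝ => (pairRotation E t p).1) p.2 0 := by
    have h1 := ((Real.hasDerivAt_cos 0).smul_const p.1).add ((Real.hasDerivAt_sin 0).smul_const p.2)
    simpa using! h1
  have h0 : (pairRotation E 0 p).1 = p.1 := by simp [pairRotation_apply]
  have hcomp : HasDerivAt (fun t : ℝ => G (pairRotation E t p).1) (fderiv ℝ G p.1 p.2) 0 := by
    refine HasFDerivAt.comp_hasDerivAt (0 : ℝ) ?_ hcurve
    rw [h0]
    exact hd.hasFDerivAt
  have hslope := hcomp.tendsto_slope_zero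
  have ht : Tendsto (fun k : ℕ => Real.pi / (2 * ((k : ℝ) + 1))) atTop (𝓝[≠] 0) := by
    refine tendsto_nhdsWithin_iff.2 ⟨?_, Eventually.of_forall fun k => ?_⟩
    · have := (tendsto_one_div_add_atTop_nhds_zero_nat (𝕜 := ℝ)).const_mul (Real.pi / 2)
      rw [mul_zero] at this
      refine this.congr fun k => ?_
      field_simp
    · have : (0 : ℝ) < Real.pi / (2 * ((k : ℝ) + 1)) := by positivity
      exact this.ne'
  have h := (hslope.comp ht).const_mul (Real.pi / 2)
  refine h.congr fun k => ?_
  simp only [Function.comp, zero_add, h0, smul_eq_mul]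
  field_simp

variable [FiniteDimensional ℝ E] [MeasurableSpace E] [BorelSpace E] (μ : Measure E)
  [μ.IsAddHaarMeasure]

theorem integrable_exp_mul_norm_prod (a : ℝ) :
    Integrable (fun p : E × E => Real.exp (a * ‖p.1‖) * Real.exp (a * ‖p.2‖))
      ((gaussianOf μ).prod (gaussianOf μ)) :=
  (integrable_exp_mul_norm_gaussianOf μ a).mul_prod (integrable_exp_mul_norm_gaussianOf μ a)

theorem integrable_exp_increment {G : E → ℝ} {Λ : ℝ≥0} (hG : LipschitzWith Λ G) (k : ℕ) :
    Integrable (fun p : E × E =>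
      Real.exp ((k + 1 : ℝ) * (G (pairRotation E (Real.pi / (2 * (k + 1))) p).1 - G p.1)))
      ((gaussianOf μ).prod (gaussianOf μ)) := by
  have := hG.continuous
  refine (integrable_exp_mul_norm_prod μ (2 * Λ)).mono'
    (Continuous.aestronglyMeasurable (by fun_prop)) (Eventually.of_forall fun p => ?_)
  rw [Real.norm_eq_abs, Real.abs_exp]
  exact exp_increment_le hG k p

/-- The difference of `G` at independent points is split into `k + 1` equal rotation steps, which
all have the same law; convexity of `exp` then bounds its exponential moment by that of one rescaled
step. -/
theorem integral_exp_sub_le_increment {G : E → ℝ} {Λ : ℝ≥0} (hG : LipschitzWith Λ G) (k : ℕ) :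
    ∫ p, Real.exp (G p.2 - G p.1) ∂(gaussianOf μ).prod (gaussianOf μ)
      ≤ ∫ p, Real.exp ((k + 1 : ℝ) * (G (pairRotation E (Real.pi / (2 * (k + 1))) p).1 - G p.1))
          ∂(gaussianOf μ).prod (gaussianOf μ) := by
  set γ₂ := (gaussianOf μ).prod (gaussianOf μ) with hγ₂
  set δ : ℝ := Real.pi / (2 * (k + 1)) with hδ
  set Φ : E × E → ℝ := fun p => Real.exp ((k + 1 : ℝ) * (G (pairRotation E δ p).1 - G p.1)) with hΦ
  have hk : (0 : ℝ) < k + 1 := by positivity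
  have hint : Integrable Φ γ₂ := integrable_exp_increment μ hG k
  have hemb : ∀ θ, MeasurableEmbedding (pairRotation E θ) := fun θ =>
    (pairRotation E θ).toHomeomorph.measurableEmbedding
  have hrot : ∀ θ, MeasurePreserving (pairRotation E θ) γ₂ γ₂ := fun θ =>
    ⟨(hemb θ).measurable, map_pairRotation_gaussianOf_prod μ θ⟩
  have hinti : ∀ θ, Integrable (fun p => Φ (pairRotation E θ p)) γ₂ := fun θ =>
    ((hrot θ).integrable_comp_emb (hemb θ)).2 hint
  have hpt : ∀ p : E × E, Real.exp (G p.2 - G p.1)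
      ≤ ∑ i ∈ Finset.range (k + 1), (k + 1 : ℝ)⁻¹ * Φ (pairRotation E (i * δ) p) := by
    intro p
    have htel : ∑ i ∈ Finset.range (k + 1),
        (G (pairRotation E δ (pairRotation E (i * δ) p)).1 - G (pairRotation E (i * δ) p).1)
        = G p.2 - G p.1 := by
      have h := Finset.sum_range_sub (fun i : ℕ => G (pairRotation E (i * δ) p).1) (k + 1)
      have hlast : ((k + 1 : ℕ) : ℝ) * δ = Real.pi / 2 := by
        rw [hδ]; push_cast; field_simp
      simp only [hlast] at h
      simp only [pairRotation_apply (Real.pi / 2), Nat.cast_zero, zero_mul, pairRotation_apply 0,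
        Real.cos_pi_div_two, Real.sin_pi_div_two, Real.cos_zero, Real.sin_zero, zero_smul, one_smul,
        zero_add, add_zero] at h
      rw [← h]
      refine Finset.sum_congr rfl fun i _ => ?_
      rw [← pairRotation_add_fst]
      push_cast
      ring_nf
    have hconv := convexOn_exp.map_sum_le (t := Finset.range (k + 1))
      (w := fun _ => (k + 1 : ℝ)⁻¹)
      (p := fun i : ℕ => (k + 1 : ℝ) *
        (G (pairRotation E δ (pairRotation E (i * δ) p)).1 - G (pairRotation E (i * δ) p).1))
      (fun _ _ => by positivity) (by simp; field_simp) (fun _ _ => Set.mem_univ _)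
    simp only [smul_eq_mul] at hconv
    refine le_trans (le_of_eq ?_) hconv
    congr 1
    rw [← htel]
    refine Finset.sum_congr rfl fun i _ => ?_
    field_simp
  calc ∫ p, Real.exp (G p.2 - G p.1) ∂γ₂
      ≤ ∫ p, ∑ i ∈ Finset.range (k + 1), (k + 1 : ℝ)⁻¹ * Φ (pairRotation E (i * δ) p) ∂γ₂ :=
        integral_mono_of_nonneg (Eventually.of_forall fun p => (Real.exp_pos _).le)
          (integrable_finsetSum _ fun i _ => (hinti _).const_mul _) (Eventually.of_forall hpt)
    _ = ∑ i ∈ Finset.range (k + 1), (k + 1 : ℝ)⁻¹ * ∫ p, Φ p ∂γ₂ := by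
        rw [integral_finsetSum _ fun i _ => (hinti _).const_mul _]
        refine Finset.sum_congr rfl fun i _ => ?_
        rw [integral_const_mul, (hrot _).integral_comp (hemb _)]
    _ = ∫ p, Φ p ∂γ₂ := by
        rw [Finset.sum_const, Finset.card_range, nsmul_eq_mul]
        push_cast
        field_simp

/-- The Maurey–Pisier inequality: the exponential moment of the difference of a `Λ`-Lipschitz
function at two independent standard Gaussian vectors. The derivative exists almost everywhere by
Rademacher's theorem, and is a Gaussian linear functional of the direction of rotation. -/
theorem integral_exp_sub_le {G : E → ℝ} {Λ : ℝ≥0} (hG : LipschitzWith Λ G) :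
    ∫ p, Real.exp (G p.2 - G p.1) ∂(gaussianOf μ).prod (gaussianOf μ)
      ≤ Real.exp (Λ ^ 2 * Real.pi ^ 2 / 8) := by
  set γ₂ := (gaussianOf μ).prod (gaussianOf μ) with hγ₂
  have hdiff : ∀ᵐ p ∂γ₂, DifferentiableAt ℝ G p.1 :=
    Measure.quasiMeasurePreserving_fst.ae
      ((tilted_absolutelyContinuous μ _).ae_le (hG.ae_differentiableAt (μ := μ)))
  have hlim : ∀ᵐ p ∂γ₂, Tendsto (fun k : ℕ => Real.exp
      ((k + 1 : ℝ) * (G (pairRotation E (Real.pi / (2 * (k + 1))) p).1 - G p.1))) atTop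
      (𝓝 (Real.exp (Real.pi / 2 * fderiv ℝ G p.1 p.2))) := by
    filter_upwards [hdiff] with p hp
    exact (Real.continuous_exp.tendsto _).comp (tendsto_rescaled_increment p hp)
  have hnorm : ∀ x, ‖fderiv ℝ G x‖ ≤ Λ := fun x => norm_fderiv_le_of_lipschitz ℝ hG
  have hlimit : Tendsto (fun k : ℕ => ∫ p, Real.exp
      ((k + 1 : ℝ) * (G (pairRotation E (Real.pi / (2 * (k + 1))) p).1 - G p.1)) ∂γ₂) atTop
      (𝓝 (∫ p, Real.exp (Real.pi / 2 * fderiv ℝ G p.1 p.2) ∂γ₂)) := by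
    refine tendsto_integral_of_dominated_convergence _
      (fun k => (integrable_exp_increment μ hG k).aestronglyMeasurable)
      (integrable_exp_mul_norm_prod μ (2 * Λ)) (fun k => Eventually.of_forall fun p => ?_) hlim
    rw [Real.norm_eq_abs, Real.abs_exp]
    exact exp_increment_le hG k p
  refine (ge_of_tendsto' hlimit fun k => integral_exp_sub_le_increment μ hG k).trans ?_
  have hint : Integrable (fun p : E × E => Real.exp (Real.pi / 2 * fderiv ℝ G p.1 p.2)) γ₂ := by
    refine (integrable_exp_mul_norm_prod μ (2 * Λ)).mono'
      (aestronglyMeasurable_of_tendsto_ae atTop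
        (fun k => (integrable_exp_increment μ hG k).aestronglyMeasurable) hlim) ?_
    filter_upwards [hlim] with p hp
    rw [Real.norm_eq_abs, Real.abs_exp]
    exact le_of_tendsto' hp fun k => exp_increment_le hG k p
  rw [integral_prod _ hint]
  have hinner : ∀ x : E, ∫ y, Real.exp (Real.pi / 2 * fderiv ℝ G x y) ∂gaussianOf μ
      ≤ Real.exp (Λ ^ 2 * Real.pi ^ 2 / 8) := by
    intro x
    set v : E := (Real.pi / 2) • (InnerProductSpace.toDual ℝ E).symm (fderiv ℝ G x) with hv
    have h1 : ∀ y, Real.pi / 2 * fderiv ℝ G x y = ⟪v, y⟫ := by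
      intro y
      rw [hv, real_inner_smul_left, InnerProductSpace.toDual_symm_apply]
    simp_rw [h1]
    rw [integral_exp_inner_gaussianOf]
    apply Real.exp_le_exp.2
    have h2 : ‖v‖ ≤ Real.pi / 2 * Λ := by
      rw [hv, norm_smul, LinearIsometryEquiv.norm_map, Real.norm_eq_abs,
        abs_of_pos (by positivity)]
      exact mul_le_mul_of_nonneg_left (hnorm x) (by positivity)
    have := pow_le_pow_left₀ (norm_nonneg v) h2 2
    nlinarith
  refine (integral_mono_of_nonneg (Eventually.of_forall fun x =>
    integral_nonneg fun y => (Real.exp_pos _).le) (integrable_const _)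
    (Eventually.of_forall hinner)).trans ?_
  simp

theorem integrable_exp_of_lipschitz {G : E → ℝ} {Λ : ℝ≥0} (hG : LipschitzWith Λ G) :
    Integrable (fun x => Real.exp (G x)) (gaussianOf μ) := by
  have := hG.continuous
  refine ((integrable_exp_mul_norm_gaussianOf μ Λ).const_mul (Real.exp (G 0))).mono'
    (Continuous.aestronglyMeasurable (by fun_prop)) (Eventually.of_forall fun x => ?_)
  rw [Real.norm_eq_abs, Real.abs_exp, ← Real.exp_add]
  apply Real.exp_le_exp.2
  have h := (le_abs_self _).trans (hG.norm_sub_le x 0)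
  rw [sub_zero] at h
  linarith

theorem integrable_of_lipschitz {G : E → ℝ} {Λ : ℝ≥0} (hG : LipschitzWith Λ G) :
    Integrable G (gaussianOf μ) := by
  refine ((integrable_exp_of_lipschitz μ hG).add (integrable_exp_of_lipschitz μ hG.neg)).mono'
    hG.continuous.aestronglyMeasurable (Eventually.of_forall fun x => ?_)
  simp only [Pi.add_apply, Pi.neg_apply]
  rw [Real.norm_eq_abs, abs_le]
  constructor <;>
    linarith [Real.add_one_le_exp (G x), Real.add_one_le_exp (-G x), Real.exp_pos (G x),
      Real.exp_pos (-G x)]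

/-- A centred Lipschitz function of a Gaussian vector is sub-Gaussian. -/
theorem integral_exp_le_of_integral_eq_zero {G : E → ℝ} {Λ : ℝ≥0} (hG : LipschitzWith Λ G)
    (h0 : ∫ x, G x ∂gaussianOf μ = 0) :
    ∫ x, Real.exp (G x) ∂gaussianOf μ ≤ Real.exp (Λ ^ 2 * Real.pi ^ 2 / 8) := by
  have h := integral_exp_sub_le μ hG
  have hsplit : ∫ p, Real.exp (G p.2 - G p.1) ∂(gaussianOf μ).prod (gaussianOf μ)
      = (∫ x, Real.exp (-G x) ∂gaussianOf μ) * ∫ y, Real.exp (G y) ∂gaussianOf μ := by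
    rw [← integral_prod_mul]
    refine integral_congr_ae (Eventually.of_forall fun p => ?_)
    simp only
    rw [← Real.exp_add]
    congr 1
    ring
  -- Jensen's inequality in the first variable, in the form `exp (-t) ≥ 1 - t`
  have hone : 1 ≤ ∫ x, Real.exp (-G x) ∂gaussianOf μ := by
    have hmono := integral_mono (μ := gaussianOf μ) (f := fun x => 1 - G x)
      ((integrable_const (1 : ℝ)).sub (integrable_of_lipschitz μ hG))
      (integrable_exp_of_lipschitz μ hG.neg)
      (fun x => by
        have := Real.add_one_le_exp (-G x)
        simp only [Pi.neg_apply]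
        linarith)
    rw [integral_sub (integrable_const _) (integrable_of_lipschitz μ hG), h0] at hmono
    simpa using hmono
  rw [hsplit] at h
  have hpos : 0 ≤ ∫ y, Real.exp (G y) ∂gaussianOf μ := integral_nonneg fun y => (Real.exp_pos _).le
  nlinarith

end MaureyPisier

/-! ### Lévy's lemma on the sphere -/

section Levy

open scoped RealInnerProductSpace NNReal

variable {E : Type*} [NormedAddCommGroup E] [InnerProductSpace ℝ E]

/-- Radial projection to the sphere through the shorter of two vectors does not increase their
distance. -/
theorem norm_mul_norm_normalize_sub_le {x y : E} (hy : y ≠ 0) (hxy : ‖y‖ ≤ ‖x‖) :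
    ‖y‖ * ‖‖x‖⁻¹ • x - ‖y‖⁻¹ • y‖ ≤ ‖x - y‖ := by
  have hs : 0 < ‖y‖ := norm_pos_iff.2 hy
  have hr : 0 < ‖x‖ := hs.trans_le hxy
  have hc : ⟪x, y⟫ ≤ ‖x‖ * ‖y‖ := real_inner_le_norm x y
  have hcr : ⟪x, y⟫ / ‖x‖ ≤ ‖y‖ := by
    rw [div_le_iff₀ hr]; linarith
  refine le_of_sq_le_sq ?_ (norm_nonneg _)
  have e1 : ‖‖x‖⁻¹ • x - ‖y‖⁻¹ • y‖ ^ 2 = 2 - 2 * (⟪x, y⟫ / (‖x‖ * ‖y‖)) := by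
    rw [norm_sub_sq_real, norm_smul, norm_smul, real_inner_smul_left, real_inner_smul_right]
    simp only [norm_inv, norm_norm]
    field_simp
    ring
  rw [mul_pow, e1, norm_sub_sq_real]
  have e2 : ‖y‖ ^ 2 * (2 - 2 * (⟪x, y⟫ / (‖x‖ * ‖y‖)))
      = 2 * ‖y‖ ^ 2 - 2 * ‖y‖ * (⟪x, y⟫ / ‖x‖) := by
    field_simp
  have e3 : ⟪x, y⟫ = ‖x‖ * (⟪x, y⟫ / ‖x‖) := by field_simp
  rw [e2]
  nlinarith

/-- The 1-homogeneous extension of a 1-Lipschitz function on the sphere with values in `[-2, 2]` is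
3-Lipschitz. -/
theorem lipschitzWith_homogeneous {f : E → ℝ} (hf : LipschitzWith 1 f)
    (hb : ∀ u : E, ‖u‖ = 1 → |f u| ≤ 2) :
    LipschitzWith 3 fun x : E => ‖x‖ * f (‖x‖⁻¹ • x) := by
  have hunit : ∀ x : E, x ≠ 0 → ‖‖x‖⁻¹ • x‖ = 1 := fun x hx => norm_smul_inv_norm (𝕜 := ℝ) hx
  have key : ∀ x y : E, ‖y‖ ≤ ‖x‖ →
      |‖x‖ * f (‖x‖⁻¹ • x) - ‖y‖ * f (‖y‖⁻¹ • y)| ≤ 3 * ‖x - y‖ := by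
    intro x y hxy
    rcases eq_or_ne x 0 with rfl | hx
    · have : y = 0 := by simpa using hxy
      simp [this]
    have hfx := hb _ (hunit x hx)
    rcases eq_or_ne y 0 with rfl | hy
    · simp only [norm_zero, zero_mul, sub_zero, abs_mul, abs_norm]
      nlinarith [norm_nonneg x]
    have h1 : |‖x‖ - ‖y‖| ≤ ‖x - y‖ := abs_norm_sub_norm_le x y
    have h2 : |f (‖x‖⁻¹ • x) - f (‖y‖⁻¹ • y)| ≤ ‖‖x‖⁻¹ • x - ‖y‖⁻¹ • y‖ := by
      simpa using hf.norm_sub_le (‖x‖⁻¹ • x) (‖y‖⁻¹ • y)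
    have h3 := norm_mul_norm_normalize_sub_le hy hxy
    calc |‖x‖ * f (‖x‖⁻¹ • x) - ‖y‖ * f (‖y‖⁻¹ • y)|
        = |(‖x‖ - ‖y‖) * f (‖x‖⁻¹ • x) + ‖y‖ * (f (‖x‖⁻¹ • x) - f (‖y‖⁻¹ • y))| := by ring_nf
      _ ≤ |‖x‖ - ‖y‖| * |f (‖x‖⁻¹ • x)| + ‖y‖ * |f (‖x‖⁻¹ • x) - f (‖y‖⁻¹ • y)| := by
          refine (abs_add_le _ _).trans ?_
          rw [abs_mul, abs_mul, abs_norm]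
      _ ≤ ‖x - y‖ * 2 + ‖y‖ * ‖‖x‖⁻¹ • x - ‖y‖⁻¹ • y‖ := by gcongr
      _ ≤ 3 * ‖x - y‖ := by linarith
  refine LipschitzWith.of_dist_le_mul fun x y => ?_
  rw [Real.dist_eq, dist_eq_norm]
  rcases le_total ‖y‖ ‖x‖ with h | h
  · exact key x y h
  · rw [abs_sub_comm, norm_sub_rev]
    exact key y x h

variable [MeasurableSpace E] [BorelSpace E]

/-- The surface measure on the unit sphere induced by a Haar measure `μ`, normalised to mass one. -/
noncomputable def sphereProb (μ : Measure E) : Measure (Metric.sphere (0 : E) 1) :=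
  (μ.toSphere Set.univ)⁻¹ • μ.toSphere

variable [FiniteDimensional ℝ E] [Nontrivial E] (μ : Measure E) [μ.IsAddHaarMeasure]

instance isProbabilityMeasure_sphereProb : IsProbabilityMeasure (sphereProb μ) := by
  have h0 : μ.toSphere Set.univ ≠ 0 := by
    rw [Ne, Measure.measure_univ_eq_zero]
    exact μ.toSphere_ne_zero
  refine ⟨?_⟩
  rw [sphereProb, Measure.smul_apply, smul_eq_mul, ENNReal.inv_mul_cancel h0 (measure_ne_top _ _)]

/-- Integration in polar coordinates: the norm and the direction of a Gaussian vector are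
independent, and the direction is uniformly distributed on the sphere. -/
theorem integral_gaussianOf_polar (φ : ℝ → ℝ) (g : E → ℝ) :
    ∫ x, φ ‖x‖ * g (‖x‖⁻¹ • x) ∂gaussianOf μ
      = (∫ x, φ ‖x‖ ∂gaussianOf μ) * ∫ u, g (u : E) ∂sphereProb μ := by
  set Z := ∫ x, Real.exp (-‖x‖ ^ 2 / 2) ∂μ with hZ
  set ψ : (ℝ → ℝ) → ℝ → ℝ := fun φ r => Real.exp (-r ^ 2 / 2) / Z * φ r with hψ
  have main : ∀ (φ : ℝ → ℝ) (g : E → ℝ), ∫ x, φ ‖x‖ * g (‖x‖⁻¹ • x) ∂gaussianOf μ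
      = (∫ u, g (u : E) ∂μ.toSphere) *
        ∫ r : Set.Ioi (0 : ℝ), ψ φ r ∂Measure.volumeIoiPow (Module.finrank ℝ E - 1) := by
    intro φ g
    unfold gaussianOf
    rw [integral_tilted,
      ← integral_prod_mul (fun u : Metric.sphere (0 : E) 1 => g u) (fun r : Set.Ioi (0 : ℝ) => ψ φ r),
      ← μ.measurePreserving_homeomorphUnitSphereProd.integral_comp
        (homeomorphUnitSphereProd E).measurableEmbedding]
    conv_lhs =>
      rw [← restrict_compl_singleton (μ := μ) 0,
        ← integral_subtype_comap (measurableSet_singleton _).compl]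
    refine integral_congr_ae (Eventually.of_forall fun x => ?_)
    simp only [homeomorphUnitSphereProd_apply_snd_coe, homeomorphUnitSphereProd_apply_fst_coe,
      restrict_compl_singleton, smul_eq_mul, hψ]
    ring
  have h1 := main φ fun _ => 1
  simp only [mul_one] at h1
  have hS : (μ.toSphere.real Set.univ) ≠ 0 := by
    rw [Measure.real, Ne, ENNReal.toReal_eq_zero_iff]
    push Not
    exact ⟨by rw [Ne, Measure.measure_univ_eq_zero]; exact μ.toSphere_ne_zero, measure_ne_top _ _⟩
  rw [main φ g, h1, sphereProb, integral_smul_measure, ENNReal.toReal_inv]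
  simp only [integral_const, smul_eq_mul, mul_one]
  change _ = _ * _ * ((μ.toSphere.real Set.univ)⁻¹ * _)
  field_simp

theorem integral_sphereProb_eq (g : E → ℝ) :
    ∫ u, g (u : E) ∂sphereProb μ = ∫ x, g (‖x‖⁻¹ • x) ∂gaussianOf μ := by
  simpa using (integral_gaussianOf_polar μ (fun _ => 1) g).symm

/-- The uniform measure on the sphere is invariant under linear isometries. -/
theorem integral_sphereProb_isometry (U : E ≃ₗᵢ[ℝ] E) (g : E → ℝ) :
    ∫ u, g (U (u : E)) ∂sphereProb μ = ∫ u, g (u : E) ∂sphereProb μ := by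
  have hemb : MeasurableEmbedding U := U.toHomeomorph.measurableEmbedding
  have hU : MeasurePreserving U (gaussianOf μ) (gaussianOf μ) :=
    ⟨hemb.measurable, map_gaussianOf_isometry μ U⟩
  rw [integral_sphereProb_eq μ fun x => g (U x), integral_sphereProb_eq μ g,
    ← hU.integral_comp hemb fun x => g (‖x‖⁻¹ • x)]
  simp

theorem integrable_sphereProb {g : E → ℝ} (hg : ContinuousOn g (Metric.sphere 0 1)) :
    Integrable (fun u : Metric.sphere (0 : E) 1 => g u) (sphereProb μ) :=
  (continuousOn_iff_continuous_domRestrict.1 hg).integrable_of_hasCompactSupport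
    (HasCompactSupport.of_compactSpace _)

/-- A centred 1-Lipschitz function on the sphere is sub-Gaussian: its 1-homogeneous extension to the
Gaussian space is a centred Lipschitz function, and Jensen's inequality for the radial variable
replaces the random radius by its mean. -/
theorem integral_exp_sphereProb_le {f : E → ℝ} (hf : LipschitzWith 1 f)
    (h0 : ∫ u, f (u : E) ∂sphereProb μ = 0) (hb : ∀ u : E, ‖u‖ = 1 → |f u| ≤ 2) (l : ℝ) :
    ∫ u, Real.exp (l * (∫ x, ‖x‖ ∂gaussianOf μ) * f (u : E)) ∂sphereProb μ
      ≤ Real.exp (9 * l ^ 2 * Real.pi ^ 2 / 8) := by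
  set r := ∫ x, ‖x‖ ∂gaussianOf μ with hr
  set F : E → ℝ := fun x => ‖x‖ * f (‖x‖⁻¹ • x) with hF
  have hFL : LipschitzWith 3 F := lipschitzWith_homogeneous hf hb
  have hGL : LipschitzWith (‖l‖₊ * 3) fun x => l * F x :=
    (lipschitzWith_smul l).comp hFL
  have hcont := hf.continuous
  have hF0 : ∫ x, F x ∂gaussianOf μ = 0 := by
    rw [hF, integral_gaussianOf_polar μ (fun t => t) f, h0, mul_zero]
  have hbound := integral_exp_le_of_integral_eq_zero μ hGL
    (by rw [integral_const_mul, hF0, mul_zero])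
  have hexp : ((‖l‖₊ * 3 : ℝ≥0) : ℝ) ^ 2 * Real.pi ^ 2 / 8 = 9 * l ^ 2 * Real.pi ^ 2 / 8 := by
    push_cast
    rw [mul_pow, Real.norm_eq_abs, sq_abs]
    ring
  rw [hexp] at hbound
  refine le_trans ?_ hbound
  set g : E → ℝ := fun x => Real.exp (l * r * f x) with hg
  have hgm : Measurable g := by
    have : Continuous g := by fun_prop
    exact this.measurable
  have hfm := hf.continuous.measurable
  set C := 2 + |f 0| with hC
  have hfb : ∀ x : E, |f (‖x‖⁻¹ • x)| ≤ C := by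
    intro x
    rcases eq_or_ne x 0 with rfl | hx
    · simp [hC]
    · have := hb _ (norm_smul_inv_norm (𝕜 := ℝ) hx)
      have h1 := abs_nonneg (f 0)
      exact this.trans (by linarith)
  have hgb : ∀ x : E, |g (‖x‖⁻¹ • x)| ≤ Real.exp (|l * r| * C) := by
    intro x
    rw [hg, Real.abs_exp]
    apply Real.exp_le_exp.2
    refine (le_abs_self _).trans ?_
    rw [abs_mul]
    gcongr
    exact hfb x
  have hmeas : Measurable fun x : E => g (‖x‖⁻¹ • x) := by fun_prop
  have hmeasf : Measurable fun x : E => f (‖x‖⁻¹ • x) := by fun_prop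
  have hI1 : Integrable (fun x : E => g (‖x‖⁻¹ • x)) (gaussianOf μ) :=
    (integrable_const (Real.exp (|l * r| * C))).mono' hmeas.aestronglyMeasurable
      (Eventually.of_forall fun x => by rw [Real.norm_eq_abs]; exact hgb x)
  have hrad : Integrable (fun x : E => ‖x‖ - r) (gaussianOf μ) :=
    (integrable_norm_gaussianOf μ).sub (integrable_const _)
  have hI2 : Integrable (fun x : E => (‖x‖ - r) * (l * f (‖x‖⁻¹ • x) * g (‖x‖⁻¹ • x)))
      (gaussianOf μ) := by
    refine hrad.mul_bdd (c := |l| * C * Real.exp (|l * r| * C)) (by fun_prop)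
      (Eventually.of_forall fun x => ?_)
    rw [Real.norm_eq_abs, abs_mul, abs_mul]
    gcongr
    · exact hfb x
    · exact hgb x
  have hzero : ∫ x, (‖x‖ - r) * (l * f (‖x‖⁻¹ • x) * g (‖x‖⁻¹ • x)) ∂gaussianOf μ = 0 := by
    rw [integral_gaussianOf_polar μ (fun t => t - r) (fun x => l * f x * g x),
      integral_sub (integrable_norm_gaussianOf μ) (integrable_const _)]
    simp [← hr]
  -- the tangent line of `r ↦ exp (l r f)` at the mean radius lies below the graph
  have hmono := integral_mono (μ := gaussianOf μ) (hI1.add hI2)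
    (integrable_exp_of_lipschitz μ hGL) (fun x => by
      have h := Real.add_one_le_exp (l * f (‖x‖⁻¹ • x) * (‖x‖ - r))
      have hpos : 0 < g (‖x‖⁻¹ • x) := Real.exp_pos _
      have e : Real.exp (l * F x)
          = g (‖x‖⁻¹ • x) * Real.exp (l * f (‖x‖⁻¹ • x) * (‖x‖ - r)) := by
        rw [hg, ← Real.exp_add]
        congr 1
        simp only [hF]
        ring
      simp only [Pi.add_apply]
      rw [e]
      nlinarith)
  simp only [Pi.add_apply] at hmono
  rw [integral_add hI1 hI2, hzero, add_zero, ← integral_sphereProb_eq μ g] at hmono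
  exact hmono

/-- Lévy's lemma: a 1-Lipschitz function on the unit sphere of an `n`-dimensional Euclidean space
exceeds its mean by more than `ε` with probability at most `exp (-n ε² / (36 π³))`. -/
theorem levy_lemma (hn : 2 ≤ Module.finrank ℝ E) {f : E → ℝ}
    (hf : LipschitzOnWith 1 f (Metric.sphere 0 1)) {ε : ℝ} (hε : 0 < ε) :
    sphereProb μ {u | f (u : E) > ∫ v, f (v : E) ∂sphereProb μ + ε}
      ≤ ENNReal.ofReal (Real.exp (-(Module.finrank ℝ E * ε ^ 2 / (36 * Real.pi ^ 3)))) := by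
  obtain ⟨f', hf', heq⟩ := hf.extend_real
  set m := ∫ v, f (v : E) ∂sphereProb μ with hm
  have hint : Integrable (fun u : Metric.sphere (0 : E) 1 => f u) (sphereProb μ) :=
    integrable_sphereProb μ hf.continuousOn
  have hfu : ∀ u : Metric.sphere (0 : E) 1, f' u = f u := fun u => (heq u.2).symm
  set f₀ : E → ℝ := fun x => f' x - m with hf₀
  have hL : LipschitzWith 1 f₀ := by
    refine LipschitzWith.of_dist_le_mul fun x y => ?_
    have := hf'.dist_le_mul x y
    simpa only [hf₀, dist_sub_right] using this
  have h0 : ∫ u, f₀ (u : E) ∂sphereProb μ = 0 := by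
    simp only [hf₀, hfu]
    rw [integral_sub hint (integrable_const _)]
    simp [hm]
  have hb : ∀ u : E, ‖u‖ = 1 → |f₀ u| ≤ 2 := by
    intro u hu
    have h1 : ∀ v : Metric.sphere (0 : E) 1, |f' u - f v| ≤ 2 := by
      intro v
      have hv : ‖(v : E)‖ = 1 := by simp
      have h2 := hf'.norm_sub_le u v
      rw [hfu v, Real.norm_eq_abs] at h2
      have h3 := norm_sub_le u (v : E)
      simp only [NNReal.coe_one, one_mul] at h2
      linarith
    have h2 : f₀ u = ∫ v, (f' u - f (v : E)) ∂sphereProb μ := by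
      rw [integral_sub (integrable_const _) hint]
      simp [hf₀, hm]
    rw [h2]
    have h3 := norm_integral_le_of_norm_le_const (μ := sphereProb μ)
      (f := fun v => f' u - f (v : E)) (C := 2) (Eventually.of_forall h1)
    simpa using h3
  set r := ∫ x, ‖x‖ ∂gaussianOf μ with hr
  have hrn : √(Module.finrank ℝ E) / 5 ≤ r := le_integral_norm_gaussianOf μ hn
  have hr0 : 0 ≤ r := le_trans (by positivity) hrn
  have hr2 : (Module.finrank ℝ E : ℝ) / 25 ≤ r ^ 2 := by
    have := pow_le_pow_left₀ (by positivity) hrn 2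
    rw [div_pow, Real.sq_sqrt (Nat.cast_nonneg _)] at this
    linarith
  -- the value of the Laplace parameter that optimises the Chernoff bound
  set l := 4 * r * ε / (9 * Real.pi ^ 2) with hl
  have hl0 : 0 ≤ l := by positivity
  have hmgf := integral_exp_sphereProb_le μ hL h0 hb l
  have hch := ProbabilityTheory.measure_ge_le_exp_mul_mgf (μ := sphereProb μ)
    (X := fun u : Metric.sphere (0 : E) 1 => f₀ u) (t := l * r) ε (by positivity) (by
      have hc : Continuous fun x => Real.exp (l * r * f₀ x) := by
        have := hL.continuous
        fun_prop
      exact integrable_sphereProb μ hc.continuousOn)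
  have hsub : {u : Metric.sphere (0 : E) 1 | f (u : E) > m + ε}
      ⊆ {u | ε ≤ f₀ (u : E)} := by
    intro u hu
    have hu' : m + ε < f u := hu
    change ε ≤ f' u - m
    rw [hfu u]
    linarith
  refine (measure_mono hsub).trans ?_
  rw [← ofReal_measureReal]
  apply ENNReal.ofReal_le_ofReal
  refine hch.trans ?_
  refine (mul_le_mul_of_nonneg_left hmgf (Real.exp_pos _).le).trans ?_
  rw [← Real.exp_add]
  apply Real.exp_le_exp.2
  have e : -(l * r) * ε + 9 * l ^ 2 * Real.pi ^ 2 / 8 = -(r ^ 2 * (2 * ε ^ 2 / (9 * Real.pi ^ 2))) := by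
    rw [hl]
    field_simp
    ring
  rw [e, neg_le_neg_iff]
  calc (Module.finrank ℝ E : ℝ) * ε ^ 2 / (36 * Real.pi ^ 3)
      ≤ Module.finrank ℝ E / 25 * (2 * ε ^ 2 / (9 * Real.pi ^ 2)) := by
        rw [div_mul_div_comm, div_le_div_iff₀ (by positivity) (by positivity)]
        have h3 := Real.pi_gt_d2
        have : 0 ≤ (Module.finrank ℝ E : ℝ) * ε ^ 2 * Real.pi ^ 2 * (72 * Real.pi - 225) := by
          have : 0 ≤ 72 * Real.pi - 225 := by linarith
          positivity
        nlinarith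
    _ ≤ r ^ 2 * (2 * ε ^ 2 / (9 * Real.pi ^ 2)) := by gcongr

end Levy

/-! ### Second moments of quadratic forms under a unitarily invariant measure -/

section Moments

open scoped InnerProductSpace ComplexConjugate

/-- The polarisation identity behind the relation between the mixed and the pure fourth moments. -/
theorem sum_norm_add_pow_four (a c : ℂ) :
    ‖a + c‖ ^ 4 + ‖a - c‖ ^ 4 + ‖a + Complex.I * c‖ ^ 4 + ‖a - Complex.I * c‖ ^ 4
      = 4 * ‖a‖ ^ 4 + 4 * ‖c‖ ^ 4 + 16 * (‖a‖ ^ 2 * ‖c‖ ^ 2) := by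
  have h : ∀ z : ℂ, ‖z‖ ^ 4 = (z.re * z.re + z.im * z.im) ^ 2 := by
    intro z
    rw [← Complex.normSq_apply, Complex.normSq_eq_norm_sq]; ring
  have h2 : ∀ z : ℂ, ‖z‖ ^ 2 = z.re * z.re + z.im * z.im := by
    intro z
    rw [← Complex.normSq_apply, Complex.normSq_eq_norm_sq]
  simp only [h, h2, Complex.add_re, Complex.sub_re, Complex.add_im, Complex.sub_im, Complex.mul_re,
    Complex.mul_im, Complex.I_re, Complex.I_im]
  ring

variable {V : Type*} [NormedAddCommGroup V] [InnerProductSpace ℂ V]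

/-- Invariance of a measure on the unit sphere under unitary maps, expressed through integrals of
real functions defined on the whole space. -/
def IsUnitarilyInvariant [MeasurableSpace V] (σ : Measure (Metric.sphere (0 : V) 1)) : Prop :=
  ∀ (U : V ≃ₗᵢ[ℂ] V) (g : V → ℝ), ∫ u, g (U (u : V)) ∂σ = ∫ u, g (u : V) ∂σ

/-- The unitary group acts transitively on the unit sphere. -/
theorem exists_isometry_apply_eq [FiniteDimensional ℂ V] {v w : V} (hv : ‖v‖ = 1) (hw : ‖w‖ = 1) :
    ∃ U : V ≃ₗᵢ[ℂ] V, U v = w := by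
  have hv0 : v ≠ 0 := by rintro rfl; simp at hv
  have : Nontrivial V := ⟨v, 0, hv0⟩
  have hd : 0 < Module.finrank ℂ V := Module.finrank_pos
  let i₀ : Fin (Module.finrank ℂ V) := ⟨0, hd⟩
  have hbasis : ∀ x : V, ‖x‖ = 1 →
      ∃ b : OrthonormalBasis (Fin (Module.finrank ℂ V)) ℂ V, b i₀ = x := by
    intro x hx
    have ho : Orthonormal ℂ (({i₀} : Set (Fin (Module.finrank ℂ V))).domRestrict fun _ => x) := by
      refine ⟨fun i => hx, fun i j hij => absurd (Subsingleton.elim i j) hij⟩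
    obtain ⟨b, hb⟩ := ho.exists_orthonormalBasis_extension_of_card_eq (by simp)
    exact ⟨b, hb i₀ rfl⟩
  obtain ⟨b, hb⟩ := hbasis v hv
  obtain ⟨c, hc⟩ := hbasis w hw
  exact ⟨b.equiv c (Equiv.refl _), by rw [← hb, OrthonormalBasis.equiv_apply_basis, ← hc]; rfl⟩

variable [FiniteDimensional ℂ V] [MeasurableSpace V] {σ : Measure (Metric.sphere (0 : V) 1)}

theorem IsUnitarilyInvariant.integral_norm_inner_pow (hσ : IsUnitarilyInvariant σ) (k : ℕ) {v w : V}
    (hw : ‖w‖ = 1) :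
    ∫ u, ‖⟪v, (u : V)⟫_ℂ‖ ^ k ∂σ = ‖v‖ ^ k * ∫ u, ‖⟪w, (u : V)⟫_ℂ‖ ^ k ∂σ := by
  rcases eq_or_ne v 0 with rfl | hv
  · rcases Nat.eq_zero_or_pos k with rfl | hk
    · simp
    · simp [hk.ne']
  obtain ⟨U, hU⟩ := exists_isometry_apply_eq (norm_smul_inv_norm (𝕜 := ℂ) hv) hw
  rw [← hσ U fun x => ‖⟪w, x⟫_ℂ‖ ^ k, ← integral_const_mul]
  refine integral_congr_ae (Eventually.of_forall fun u => ?_)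
  have hv' : (‖v‖ : ℝ) ≠ 0 := norm_ne_zero_iff.2 hv
  simp only
  rw [← hU, LinearIsometryEquiv.inner_map_map, inner_smul_left, norm_mul, mul_pow]
  simp only [map_inv₀, norm_inv, RCLike.norm_conj, RCLike.norm_ofReal, abs_norm]
  rw [← mul_assoc, ← mul_pow, mul_inv_cancel₀ hv', one_pow, one_mul]

variable [BorelSpace V] [IsProbabilityMeasure σ]

theorem integrable_sphere_of_continuous {g : V → ℝ} (hg : Continuous g) :
    Integrable (fun u : Metric.sphere (0 : V) 1 => g u) σ := by
  have : ProperSpace V := FiniteDimensional.proper ℂ V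
  exact (hg.comp continuous_subtype_val).integrable_of_hasCompactSupport
    (HasCompactSupport.of_compactSpace _)

/-- The fourth moments of the coordinates of a uniformly distributed unit vector in an orthonormal
basis: every mixed moment is half of the common pure moment. -/
theorem IsUnitarilyInvariant.integral_mul_coord (hσ : IsUnitarilyInvariant σ)
    {ι : Type*} [Fintype ι] [DecidableEq ι] (b : OrthonormalBasis ι ℂ V) (i₀ i j : ι) :
    ∫ u, ‖⟪b i, (u : V)⟫_ℂ‖ ^ 2 * ‖⟪b j, (u : V)⟫_ℂ‖ ^ 2 ∂σ
      = (if i = j then 2 else 1) * ((∫ u, ‖⟪b i₀, (u : V)⟫_ℂ‖ ^ 4 ∂σ) / 2) := by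
  set α := ∫ u, ‖⟪b i₀, (u : V)⟫_ℂ‖ ^ 4 ∂σ with hα
  have hmom : ∀ v : V, ∫ u, ‖⟪v, (u : V)⟫_ℂ‖ ^ 4 ∂σ = ‖v‖ ^ 4 * α := fun v =>
    hσ.integral_norm_inner_pow 4 (by simp)
  have hint : ∀ v : V, Integrable (fun u : Metric.sphere (0 : V) 1 => ‖⟪v, (u : V)⟫_ℂ‖ ^ 4) σ :=
    fun v => integrable_sphere_of_continuous (g := fun x => ‖⟪v, x⟫_ℂ‖ ^ 4) (by fun_prop)
  split_ifs with hij
  · subst hij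
    have h := hmom (b i)
    rw [b.norm_eq_one, one_pow, one_mul] at h
    rw [mul_div_cancel₀ _ (by norm_num), ← h]
    refine integral_congr_ae (Eventually.of_forall fun u => ?_)
    ring
  · have horth : ⟪b i, b j⟫_ℂ = 0 := b.orthonormal.2 hij
    have hnorm : ∀ c : ℂ, ‖c‖ = 1 → ‖b i + c • b j‖ ^ 4 = 4 := by
      intro c hc
      have h := norm_add_sq_eq_norm_sq_add_norm_sq_of_inner_eq_zero (b i) (c • b j)
        (by rw [inner_smul_right, horth, mul_zero])
      rw [norm_smul, hc, b.norm_eq_one, b.norm_eq_one] at h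
      have : ‖b i + c • b j‖ ^ 4 = (‖b i + c • b j‖ * ‖b i + c • b j‖) ^ 2 := by ring
      rw [this, h]; norm_num
    have hint2 : Integrable (fun u : Metric.sphere (0 : V) 1 =>
        ‖⟪b i, (u : V)⟫_ℂ‖ ^ 2 * ‖⟪b j, (u : V)⟫_ℂ‖ ^ 2) σ :=
      integrable_sphere_of_continuous
        (g := fun x => ‖⟪b i, x⟫_ℂ‖ ^ 2 * ‖⟪b j, x⟫_ℂ‖ ^ 2) (by fun_prop)
    have hpt : ∀ u : V, ‖⟪b i + (1 : ℂ) • b j, u⟫_ℂ‖ ^ 4 + ‖⟪b i + (-1 : ℂ) • b j, u⟫_ℂ‖ ^ 4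
          + ‖⟪b i + (-Complex.I) • b j, u⟫_ℂ‖ ^ 4 + ‖⟪b i + Complex.I • b j, u⟫_ℂ‖ ^ 4
        = 4 * ‖⟪b i, u⟫_ℂ‖ ^ 4 + 4 * ‖⟪b j, u⟫_ℂ‖ ^ 4
          + 16 * (‖⟪b i, u⟫_ℂ‖ ^ 2 * ‖⟪b j, u⟫_ℂ‖ ^ 2) := by
      intro u
      rw [← sum_norm_add_pow_four]
      simp only [inner_add_left, inner_smul_left, map_one, map_neg, Complex.conj_I, one_mul, neg_mul,
        neg_neg, ← sub_eq_add_neg]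
    have hI := integral_congr_ae (μ := σ) (Eventually.of_forall fun u : Metric.sphere (0 : V) 1 =>
      hpt u)
    rw [integral_add (((hint _).fun_add (hint _)).fun_add (hint _)) (hint _),
      integral_add ((hint _).fun_add (hint _)) (hint _), integral_add (hint _) (hint _),
      integral_add (((hint _).const_mul _).fun_add ((hint _).const_mul _)) (hint2.const_mul _),
      integral_add ((hint _).const_mul _) ((hint _).const_mul _), integral_const_mul,
      integral_const_mul, integral_const_mul, hmom, hmom, hmom, hmom, hmom, hmom,
      hnorm _ (by simp), hnorm _ (by simp), hnorm _ (by simp), hnorm _ (by simp),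
      b.norm_eq_one, b.norm_eq_one] at hI
    linarith

/-- For real weights `l i ∈ [0, 1]` the random variable `∑ l i |⟨b i, u⟩|²` has mean
`(∑ l i) / d` and variance at most `1 / d`; hence its mean absolute deviation is at most
`1 / √d`. -/
theorem IsUnitarilyInvariant.integral_abs_sub_le (hσ : IsUnitarilyInvariant σ)
    {ι : Type*} [Fintype ι] [Nonempty ι] (b : OrthonormalBasis ι ℂ V) (l : ι → ℝ)
    (hl0 : ∀ i, 0 ≤ l i) (hl1 : ∀ i, l i ≤ 1) :
    ∫ u, |∑ i, l i * ‖⟪b i, (u : V)⟫_ℂ‖ ^ 2 - (∑ i, l i) / Fintype.card ι| ∂σ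
      ≤ 1 / √(Fintype.card ι) := by
  classical
  obtain ⟨i₀⟩ := ‹Nonempty ι›
  set d : ℝ := (Fintype.card ι : ℝ) with hd
  have hd1 : 1 ≤ d := by
    rw [hd]; exact_mod_cast Fintype.card_pos_iff.2 ⟨i₀⟩
  have hd0 : 0 < d := by linarith
  set p : ι → Metric.sphere (0 : V) 1 → ℝ := fun i u => ‖⟪b i, (u : V)⟫_ℂ‖ ^ 2 with hp
  set S := ∑ i, l i with hS
  have hunit : ∀ u : Metric.sphere (0 : V) 1, ∑ i, p i u = 1 := by
    intro u
    have h := b.sum_sq_norm_inner_right (u : V)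
    simpa [hp] using h
  have hpint : ∀ i, Integrable (p i) σ := fun i =>
    integrable_sphere_of_continuous (g := fun x => ‖⟪b i, x⟫_ℂ‖ ^ 2) (by fun_prop)
  have hppint : ∀ i j, Integrable (fun u => p i u * p j u) σ := fun i j =>
    integrable_sphere_of_continuous
      (g := fun x => ‖⟪b i, x⟫_ℂ‖ ^ 2 * ‖⟪b j, x⟫_ℂ‖ ^ 2) (by fun_prop)
  have hp1 : ∀ i, ∫ u, p i u ∂σ = 1 / d := by
    have hc : ∀ i, ∫ u, p i u ∂σ = ∫ u, p i₀ u ∂σ := by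
      intro i
      have := hσ.integral_norm_inner_pow 2 (v := b i) (w := b i₀) (by simp)
      simpa [hp] using this
    have h := integral_finsetSum (μ := σ) Finset.univ fun i _ => hpint i
    simp only [hunit, hc, Finset.sum_const, Finset.card_univ, nsmul_eq_mul] at h
    rw [integral_const, probReal_univ, one_smul, ← hd] at h
    intro i
    rw [hc i]
    field_simp
    linarith
  set t := (∫ u, ‖⟪b i₀, (u : V)⟫_ℂ‖ ^ 4 ∂σ) / 2 with ht
  have hp2 : ∀ i j, ∫ u, p i u * p j u ∂σ = (if i = j then 2 else 1) * t := fun i j =>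
    hσ.integral_mul_coord b i₀ i j
  have hdouble : ∀ m : ι → ℝ, ∑ i, ∑ j, m i * m j * ((if i = j then 2 else 1) * t)
      = t * ∑ i, m i ^ 2 + t * (∑ i, m i) ^ 2 := by
    intro m
    have h1 : ∀ i j, m i * m j * ((if i = j then 2 else 1) * t)
        = t * (m i * m j) + if i = j then t * m i ^ 2 else 0 := by
      intro i j
      split_ifs with h
      · subst h; ring
      · ring
    simp_rw [h1, Finset.sum_add_distrib, Finset.sum_ite_eq, Finset.mem_univ, if_true,
      ← Finset.mul_sum]
    rw [sq, Finset.sum_mul]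
    ring
  have hsq : ∀ (m : ι → ℝ) (u : Metric.sphere (0 : V) 1),
      (∑ i, m i * p i u) ^ 2 = ∑ i, ∑ j, m i * m j * (p i u * p j u) := by
    intro m u
    rw [sq, Finset.sum_mul_sum]
    refine Finset.sum_congr rfl fun i _ => Finset.sum_congr rfl fun j _ => ?_
    ring
  have hsqint : ∀ m : ι → ℝ, Integrable (fun u => (∑ i, m i * p i u) ^ 2) σ := by
    intro m
    simp_rw [hsq]
    exact integrable_finsetSum _ fun i _ => integrable_finsetSum _ fun j _ =>
      (hppint i j).const_mul _
  have hE2 : ∀ m : ι → ℝ, ∫ u, (∑ i, m i * p i u) ^ 2 ∂σ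
      = t * ∑ i, m i ^ 2 + t * (∑ i, m i) ^ 2 := by
    intro m
    simp_rw [hsq]
    rw [integral_finsetSum _ fun i _ => integrable_finsetSum _ fun j _ => (hppint i j).const_mul _,
      ← hdouble]
    refine Finset.sum_congr rfl fun i _ => ?_
    rw [integral_finsetSum _ fun j _ => (hppint i j).const_mul _]
    refine Finset.sum_congr rfl fun j _ => ?_
    rw [integral_const_mul, hp2]
  -- the normalisation `∑ |⟨b i, u⟩|² = 1` determines the common factor
  have htval : t = 1 / (d * (d + 1)) := by
    have h := hE2 fun _ => 1
    simp only [one_mul, hunit, one_pow, Finset.sum_const, Finset.card_univ, nsmul_eq_mul, mul_one]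
      at h
    rw [integral_const, probReal_univ, one_smul, ← hd] at h
    rw [eq_div_iff (by positivity)]
    linarith
  have hlint : Integrable (fun u => ∑ i, l i * p i u) σ :=
    integrable_finsetSum _ fun i _ => (hpint i).const_mul _
  have hE1 : ∫ u, ∑ i, l i * p i u ∂σ = S / d := by
    rw [integral_finsetSum _ fun i _ => (hpint i).const_mul _, hS, Finset.sum_div]
    refine Finset.sum_congr rfl fun i _ => ?_
    rw [integral_const_mul, hp1]
    ring
  have hYint : Integrable (fun u => (∑ i, l i * p i u - S / d) ^ 2) σ := by
    have : ∀ u, (∑ i, l i * p i u - S / d) ^ 2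
        = (∑ i, l i * p i u) ^ 2 - 2 * (S / d) * (∑ i, l i * p i u) + (S / d) ^ 2 := fun u => by ring
    simp_rw [this]
    exact ((hsqint l).sub (hlint.const_mul _)).add (integrable_const _)
  have hvar : ∫ u, (∑ i, l i * p i u - S / d) ^ 2 ∂σ ≤ 1 / d := by
    have : ∀ u, (∑ i, l i * p i u - S / d) ^ 2
        = (∑ i, l i * p i u) ^ 2 - 2 * (S / d) * (∑ i, l i * p i u) + (S / d) ^ 2 := fun u => by ring
    simp_rw [this]
    have hsub : Integrable (fun u => (∑ i, l i * p i u) ^ 2 - 2 * (S / d) * ∑ i, l i * p i u) σ :=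
      (hsqint l).sub (hlint.const_mul _)
    rw [integral_add hsub (integrable_const _),
      integral_sub (hsqint l) (hlint.const_mul _), integral_const_mul, hE2, hE1, integral_const,
      probReal_univ, one_smul]
    have hl2 : ∑ i, l i ^ 2 ≤ d := by
      calc ∑ i, l i ^ 2 ≤ ∑ _i : ι, (1 : ℝ) :=
            Finset.sum_le_sum fun i _ => pow_le_one₀ (hl0 i) (hl1 i)
        _ = d := by simp [hd]
    have ht0 : 0 ≤ t := by rw [htval]; positivity
    have ht1 : t ≤ 1 / d ^ 2 := by
      rw [htval]
      apply one_div_le_one_div_of_le (by positivity)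
      nlinarith
    have h1 : t * ∑ i, l i ^ 2 ≤ 1 / d := by
      calc t * ∑ i, l i ^ 2 ≤ 1 / d ^ 2 * d := by gcongr
        _ = 1 / d := by field_simp
    have h2 : t * S ^ 2 ≤ 1 / d ^ 2 * S ^ 2 := by gcongr
    have h3 : 1 / d ^ 2 * S ^ 2 - 2 * (S / d) * (S / d) + (S / d) ^ 2 = 0 := by
      field_simp; ring
    linarith
  have hs : √d ^ 2 = d := Real.sq_sqrt hd0.le
  have hs0 : 0 < √d := Real.sqrt_pos.2 hd0
  -- the arithmetic-geometric mean inequality turns the variance bound into a first-moment bound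
  have hpt : ∀ u, |∑ i, l i * p i u - S / d|
      ≤ √d / 2 * (∑ i, l i * p i u - S / d) ^ 2 + 1 / (2 * √d) := by
    intro u
    set y := ∑ i, l i * p i u - S / d
    have h1 : 0 ≤ (√d * |y| - 1) ^ 2 / (2 * √d) := by positivity
    have h2 : (√d * |y| - 1) ^ 2 / (2 * √d) = √d / 2 * y ^ 2 + 1 / (2 * √d) - |y| := by
      rw [← sq_abs y]
      field_simp
      ring
    linarith
  refine (integral_mono_of_nonneg (Eventually.of_forall fun u => abs_nonneg _)
    ((hYint.const_mul _).add (integrable_const _)) (Eventually.of_forall hpt)).trans ?_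
  simp only [Pi.add_apply]
  rw [integral_add (hYint.const_mul _) (integrable_const _), integral_const_mul, integral_const,
    probReal_univ, one_smul]
  calc √d / 2 * ∫ u, (∑ i, l i * p i u - S / d) ^ 2 ∂σ + 1 / (2 * √d)
      ≤ √d / 2 * (1 / d) + 1 / (2 * √d) := by gcongr
    _ = 1 / √d := by
      conv_lhs => rw [← hs]
      rw [Real.sqrt_sq hs0.le]
      field_simp
      norm_num

end Moments

/-! ### Distinguishability of pure states -/

section Distinguishability

open scoped InnerProductSpace

variable {H : Type*} [NormedAddCommGroup H] [InnerProductSpace ℂ H]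

theorem POVM.sum_re_inner (A : POVM H) (x y : H) :
    ∑ a, (⟪x, A.effect a y⟫_ℂ).re = (⟪x, y⟫_ℂ).re := by
  have h : ∑ a, A.effect a y = y := by
    have := congrArg (fun T : H →L[ℂ] H => T y) A.sum_eq_one
    simpa [sum_apply] using this
  rw [← Complex.re_sum, ← inner_sum, h]

theorem POVM.re_inner_nonneg (A : POVM H) (a : Fin A.numOutcomes) (x : H) :
    0 ≤ (⟪x, A.effect a x⟫_ℂ).re := (A.isPositive a).re_inner_nonneg_right x

theorem POVM.re_inner_le (A : POVM H) (a : Fin A.numOutcomes) (x : H) :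
    (⟪x, A.effect a x⟫_ℂ).re ≤ ‖x‖ ^ 2 := by
  have h := A.sum_re_inner x x
  have h2 : (⟪x, x⟫_ℂ).re = ‖x‖ ^ 2 := (norm_sq_eq_re_inner (𝕜 := ℂ) x).symm
  rw [← h2, ← h]
  exact Finset.single_le_sum (fun a _ => A.re_inner_nonneg a x) (Finset.mem_univ a)

/-- Polarisation: the difference of two diagonal matrix elements of a symmetric operator. -/
theorem norm_inner_sub_inner_eq {M : H →L[ℂ] H} (hM : (M : H →ₗ[ℂ] H).IsSymmetric) (x y : H) :
    ‖⟪x, M x⟫_ℂ - ⟪y, M y⟫_ℂ‖ = |(⟪x - y, M (x + y)⟫_ℂ).re| := by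
  have him : ∀ z, (⟪z, M z⟫_ℂ).im = 0 := fun z => hM.im_inner_self_apply z
  have hre : (⟪y, M x⟫_ℂ).re = (⟪x, M y⟫_ℂ).re := by
    have h1 : ⟪M y, x⟫_ℂ = ⟪y, M x⟫_ℂ := hM y x
    rw [← h1, ← inner_conj_symm, Complex.conj_re]
  have h : ⟪x, M x⟫_ℂ - ⟪y, M y⟫_ℂ = (((⟪x - y, M (x + y)⟫_ℂ).re : ℝ) : ℂ) := by
    apply Complex.ext
    · simp only [map_add, inner_sub_left, inner_add_right, Complex.sub_re, Complex.add_re,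
        Complex.ofReal_re, hre]
      ring
    · simp [him]
  rw [h, Complex.norm_real, Real.norm_eq_abs]

/-- A Cauchy–Schwarz inequality for the family of positive forms of a POVM. -/
theorem POVM.sum_abs_re_inner_le (A : POVM H) (x y : H) (hx : x ≠ 0) (hy : ‖y‖ ≤ 2) :
    ∑ a, |(⟪x, A.effect a y⟫_ℂ).re| ≤ 2 * ‖x‖ := by
  have hx0 : 0 < ‖x‖ := norm_pos_iff.2 hx
  set s : ℝ := 2 / ‖x‖ with hs
  have hs0 : 0 < s := by positivity
  -- positivity of the form at `s x ± y`
  have key : ∀ a, |(⟪x, A.effect a y⟫_ℂ).re|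
      ≤ (s * (⟪x, A.effect a x⟫_ℂ).re + (⟪y, A.effect a y⟫_ℂ).re / s) / 2 := by
    intro a
    have hsym := (A.isPositive a).isSymmetric
    have hre : (⟪y, A.effect a x⟫_ℂ).re = (⟪x, A.effect a y⟫_ℂ).re := by
      have h1 : ⟪A.effect a y, x⟫_ℂ = ⟪y, A.effect a x⟫_ℂ := hsym y x
      rw [← h1, ← inner_conj_symm, Complex.conj_re]
    have e1 := A.re_inner_nonneg a ((s : ℂ) • x + y)
    have e2 := A.re_inner_nonneg a ((s : ℂ) • x - y)
    simp only [map_add, map_sub, map_smul, inner_add_left, inner_sub_left, inner_add_right,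
      inner_sub_right, inner_smul_left, inner_smul_right, Complex.add_re, Complex.sub_re,
      Complex.conj_ofReal, Complex.re_ofReal_mul, hre] at e1 e2
    set X := (⟪x, A.effect a x⟫_ℂ).re
    set B := (⟪x, A.effect a y⟫_ℂ).re
    set Q := (⟪y, A.effect a y⟫_ℂ).re / s with hQ
    have hY : (⟪y, A.effect a y⟫_ℂ).re = s * Q := by rw [hQ]; field_simp
    rw [hY] at e1 e2
    have f1 : 0 ≤ s * (s * X + 2 * B + Q) := by linarith
    have f2 : 0 ≤ s * (s * X - 2 * B + Q) := by linarith
    have g1 := nonneg_of_mul_nonneg_right f1 hs0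
    have g2 := nonneg_of_mul_nonneg_right f2 hs0
    rw [abs_le]
    constructor <;> linarith
  have hxx : (⟪x, x⟫_ℂ).re = ‖x‖ ^ 2 := (norm_sq_eq_re_inner (𝕜 := ℂ) x).symm
  have hyy : (⟪y, y⟫_ℂ).re = ‖y‖ ^ 2 := (norm_sq_eq_re_inner (𝕜 := ℂ) y).symm
  calc ∑ a, |(⟪x, A.effect a y⟫_ℂ).re|
      ≤ ∑ a, (s * (⟪x, A.effect a x⟫_ℂ).re + (⟪y, A.effect a y⟫_ℂ).re / s) / 2 :=
        Finset.sum_le_sum fun a _ => key a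
    _ = (s * ‖x‖ ^ 2 + ‖y‖ ^ 2 / s) / 2 := by
        rw [← Finset.sum_div, Finset.sum_add_distrib, ← Finset.mul_sum, ← Finset.sum_div,
          A.sum_re_inner, A.sum_re_inner, hxx, hyy]
    _ ≤ (s * ‖x‖ ^ 2 + 2 ^ 2 / s) / 2 := by gcongr
    _ = 2 * ‖x‖ := by rw [hs]; field_simp; ring

variable [FiniteDimensional ℂ H]

theorem QState.tr_mul_pureState (M : H →L[ℂ] H) (v : H) :
    QState.tr (M * QState.pureState v) = ⟪v, M v⟫_ℂ := by
  have h : M * QState.pureState v = InnerProductSpace.rankOne ℂ (M v) v :=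
    InnerProductSpace.comp_rankOne v v M
  rw [QState.tr, h, InnerProductSpace.trace_rankOne]

theorem QState.tr_mul_maxMixed (M : H →L[ℂ] H) (K : Submodule ℂ H) {ι : Type*} [Fintype ι]
    (b : OrthonormalBasis ι ℂ K) :
    QState.tr (M * QState.maxMixed K)
      = (∑ i, ⟪(b i : H), M (b i : H)⟫_ℂ) / (Module.finrank ℂ K : ℂ) := by
  have h : M * QState.maxMixed K = ((Module.finrank ℂ K : ℂ)⁻¹) •
      ∑ i, InnerProductSpace.rankOne ℂ (M (b i : H)) (b i : H) := by
    rw [QState.maxMixed, b.starProjection_eq_sum_rankOne, mul_smul_comm, Finset.mul_sum]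
    congr 1
    refine Finset.sum_congr rfl fun i _ => ?_
    exact InnerProductSpace.comp_rankOne _ _ M
  rw [QState.tr, h, ContinuousLinearMap.toLinearMap_smul, ContinuousLinearMap.toLinearMap_sum,
    map_smul, map_sum, smul_eq_mul, div_eq_inv_mul]
  simp_rw [InnerProductSpace.trace_rankOne]

/-- On unit vectors the distinguishability from a fixed operator by one measurement is 1-Lipschitz. -/
theorem QState.distinguish_pureState_le (A : POVM H) (ρ : H →L[ℂ] H) {x y : H}
    (hx : ‖x‖ = 1) (hy : ‖y‖ = 1) :
    QState.distinguish A (QState.pureState x) ρ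
      ≤ QState.distinguish A (QState.pureState y) ρ + ‖x - y‖ := by
  rcases eq_or_ne x y with rfl | hxy
  · simp
  have hsum : ‖x + y‖ ≤ 2 := (norm_add_le x y).trans (by rw [hx, hy]; norm_num)
  have h := A.sum_abs_re_inner_le (x - y) (x + y) (sub_ne_zero.2 hxy) hsum
  have hpt : ∀ a, ‖QState.tr (A.effect a * QState.pureState x) - QState.tr (A.effect a * ρ)‖
      ≤ ‖QState.tr (A.effect a * QState.pureState y) - QState.tr (A.effect a * ρ)‖
        + |(⟪x - y, A.effect a (x + y)⟫_ℂ).re| := by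
    intro a
    rw [← norm_inner_sub_inner_eq (A.isPositive a).isSymmetric, QState.tr_mul_pureState,
      QState.tr_mul_pureState]
    refine le_trans (le_of_eq ?_) (norm_add_le _ _)
    congr 1
    ring
  have hs := Finset.sum_le_sum fun a (_ : a ∈ Finset.univ) => hpt a
  rw [Finset.sum_add_distrib] at hs
  unfold QState.distinguish
  linarith

theorem QState.lipschitzOnWith_distinguishSet (𝒜 : Finset (POVM H)) (h𝒜 : 𝒜.Nonempty)
    (ρ : H →L[ℂ] H) :
    LipschitzOnWith 1 (fun v => QState.distinguishSet 𝒜 h𝒜 (QState.pureState v) ρ)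
      (Metric.sphere 0 1) := by
  have key : ∀ x y : H, ‖x‖ = 1 → ‖y‖ = 1 → QState.distinguishSet 𝒜 h𝒜 (QState.pureState x) ρ
      ≤ QState.distinguishSet 𝒜 h𝒜 (QState.pureState y) ρ + ‖x - y‖ := by
    intro x y hx hy
    refine Finset.sup'_le _ _ fun A hA => ?_
    refine (QState.distinguish_pureState_le A ρ hx hy).trans ?_
    gcongr
    exact Finset.le_sup' (fun A => QState.distinguish A (QState.pureState y) ρ) hA
  refine LipschitzOnWith.of_dist_le_mul fun x hx y hy => ?_
  have hx' : ‖x‖ = 1 := by simpa using hx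
  have hy' : ‖y‖ = 1 := by simpa using hy
  rw [Real.dist_eq, dist_eq_norm, NNReal.coe_one, one_mul, abs_le]
  have h1 := key x y hx' hy'
  have h2 := key y x hy' hx'
  rw [norm_sub_rev] at h2
  constructor <;> linarith

theorem QState.continuous_distinguishSet (𝒜 : Finset (POVM H)) (h𝒜 : 𝒜.Nonempty)
    (ρ : H →L[ℂ] H) :
    Continuous fun v => QState.distinguishSet 𝒜 h𝒜 (QState.pureState v) ρ := by
  unfold QState.distinguishSet
  refine Continuous.finset_sup'_apply h𝒜 fun A _ => ?_
  unfold QState.distinguish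
  simp_rw [QState.tr_mul_pureState]
  fun_prop

/-- The spectral form of a POVM element compressed to a subspace `K`. -/
theorem POVM.exists_orthonormalBasis (A : POVM H) (a : Fin A.numOutcomes) (K : Submodule ℂ H) :
    ∃ (b : OrthonormalBasis (Fin (Module.finrank ℂ K)) ℂ K) (l : Fin (Module.finrank ℂ K) → ℝ),
      (∀ i, 0 ≤ l i) ∧ (∀ i, l i ≤ 1) ∧
      (∀ i, ⟪(b i : H), A.effect a (b i : H)⟫_ℂ = l i) ∧
      ∀ u : K, ⟪(u : H), A.effect a (u : H)⟫_ℂ = ((∑ i, l i * ‖⟪b i, u⟫_ℂ‖ ^ 2 : ℝ) : ℂ) := by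
  have hsym := (A.isPositive a).isSymmetric
  set T : K →ₗ[ℂ] K :=
    ((K.orthogonalProjectionOnto ∘L A.effect a ∘L K.subtypeL : K →L[ℂ] K) : K →ₗ[ℂ] K) with hT
  have hinner : ∀ x y : K, ⟪x, T y⟫_ℂ = ⟪(x : H), A.effect a (y : H)⟫_ℂ := by
    intro x y
    simp [hT]
  have hTsym : T.IsSymmetric := by
    intro x y
    rw [hinner, ← inner_conj_symm, hinner, inner_conj_symm]
    exact hsym x y
  set b := hTsym.eigenvectorBasis rfl with hb
  set l := hTsym.eigenvalues rfl with hl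
  have happ : ∀ i, T (b i) = (l i : ℂ) • b i := fun i => hTsym.apply_eigenvectorBasis rfl i
  have hdiag : ∀ i, ⟪(b i : H), A.effect a (b i : H)⟫_ℂ = l i := by
    intro i
    rw [← hinner, happ, inner_smul_right, inner_self_eq_norm_sq_to_K, b.norm_eq_one]
    simp
  refine ⟨b, l, fun i => ?_, fun i => ?_, hdiag, fun u => ?_⟩
  · have := A.re_inner_nonneg a (b i : H)
    rwa [hdiag, Complex.ofReal_re] at this
  · have := A.re_inner_le a (b i : H)
    have hb1 : ‖(b i : H)‖ = 1 := b.norm_eq_one i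
    rwa [hdiag, Complex.ofReal_re, hb1, one_pow] at this
  · rw [← hinner, ← b.sum_inner_mul_inner]
    push_cast
    refine Finset.sum_congr rfl fun i _ => ?_
    rw [← hTsym, happ, inner_smul_left, Complex.conj_ofReal, ← inner_conj_symm u (b i),
      mul_left_comm, Complex.conj_mul']

variable [MeasurableSpace H] [BorelSpace H]

/-- The mean distinguishability of a uniformly distributed pure state of `K` from the maximally
mixed state of `K`: each outcome contributes at most `1 / (2 √d)`. -/
theorem QState.integral_distinguishSet_le (K : Submodule ℂ H) (hK : K ≠ ⊥)
    {σ : Measure (Metric.sphere (0 : K) 1)} [IsProbabilityMeasure σ] (hσ : IsUnitarilyInvariant σ)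
    (𝒜 : Finset (POVM H)) (h𝒜 : 𝒜.Nonempty) :
    ∫ u, QState.distinguishSet 𝒜 h𝒜 (QState.pureState ((u : K) : H)) (QState.maxMixed K) ∂σ
      ≤ (QState.totalOutcomes 𝒜 : ℝ) / (2 * √(Module.finrank ℂ K : ℝ)) := by
  have hnt : Nontrivial K := Submodule.nontrivial_iff_ne_bot.2 hK
  have : Nonempty (Fin (Module.finrank ℂ K)) := ⟨⟨0, Module.finrank_pos⟩⟩
  set f : (A : POVM H) → Fin A.numOutcomes → K → ℝ := fun A a v =>
    ‖QState.tr (A.effect a * QState.pureState (v : H))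
      - QState.tr (A.effect a * QState.maxMixed K)‖ with hf
  have hfint : ∀ A a, Integrable (fun u : Metric.sphere (0 : K) 1 => f A a u) σ := by
    intro A a
    refine integrable_sphere_of_continuous ?_
    simp only [hf, QState.tr_mul_pureState]
    fun_prop
  have hout : ∀ A a, ∫ u, f A a (u : K) ∂σ ≤ 1 / √(Module.finrank ℂ K : ℝ) := by
    intro A a
    obtain ⟨b, l, hl0, hl1, hdiag, hform⟩ := A.exists_orthonormalBasis a K
    have h := hσ.integral_abs_sub_le b l hl0 hl1
    rw [Fintype.card_fin] at h
    refine le_trans (le_of_eq ?_) h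
    refine integral_congr_ae (Eventually.of_forall fun u => ?_)
    simp only [hf]
    rw [QState.tr_mul_pureState, QState.tr_mul_maxMixed _ K b, hform]
    simp_rw [hdiag]
    rw [← Real.norm_eq_abs, ← Complex.norm_real]
    congr 1
    push_cast
    rfl
  have hpt : ∀ v : K, QState.distinguishSet 𝒜 h𝒜 (QState.pureState (v : H)) (QState.maxMixed K)
      ≤ ∑ A ∈ 𝒜, 1 / 2 * ∑ a, f A a v := by
    intro v
    refine Finset.sup'_le _ _ fun A hA => ?_
    exact Finset.single_le_sum (f := fun A => 1 / 2 * ∑ a, f A a v)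
      (fun A _ => mul_nonneg (by norm_num) (Finset.sum_nonneg fun a _ => norm_nonneg _)) hA
  have hint1 : ∀ A, Integrable (fun u : Metric.sphere (0 : K) 1 => 1 / 2 * ∑ a, f A a u) σ :=
    fun A => (integrable_finsetSum _ fun a _ => hfint A a).const_mul _
  calc ∫ u, QState.distinguishSet 𝒜 h𝒜 (QState.pureState ((u : K) : H)) (QState.maxMixed K) ∂σ
      ≤ ∫ u, ∑ A ∈ 𝒜, 1 / 2 * ∑ a, f A a (u : K) ∂σ :=
        integral_mono
          (integrable_sphere_of_continuous (g := fun v : K =>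
            QState.distinguishSet 𝒜 h𝒜 (QState.pureState (v : H)) (QState.maxMixed K))
            ((QState.continuous_distinguishSet 𝒜 h𝒜 _).comp continuous_subtype_val))
          (integrable_finsetSum _ fun A _ => hint1 A) fun u => hpt u
    _ = ∑ A ∈ 𝒜, 1 / 2 * ∑ a, ∫ u, f A a (u : K) ∂σ := by
        rw [integral_finsetSum _ fun A _ => hint1 A]
        refine Finset.sum_congr rfl fun A _ => ?_
        rw [integral_const_mul, integral_finsetSum _ fun a _ => hfint A a]
    _ ≤ ∑ A ∈ 𝒜, 1 / 2 * ∑ _a : Fin A.numOutcomes, 1 / √(Module.finrank ℂ K : ℝ) := by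
        gcongr with A _ a _
        exact hout A a
    _ = (QState.totalOutcomes 𝒜 : ℝ) / (2 * √(Module.finrank ℂ K : ℝ)) := by
        simp only [Finset.sum_const, Finset.card_univ, Fintype.card_fin, nsmul_eq_mul,
          QState.totalOutcomes, Nat.cast_sum, Finset.sum_div]
        refine Finset.sum_congr rfl fun A _ => ?_
        rw [mul_comm 2 (√_), ← div_div]
        ring

end Distinguishability

/-! ### Time evolution and infinite-time averages -/

section Evolution

open scoped InnerProductSpace Nat

/-- The restriction of a continuous function on a torus to a one-parameter subgroup has a time
average. This is an explicit integral for characters, the trigonometric polynomials are uniformly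
dense, and the averages are contractive for the supremum norm. -/
theorem exists_tendsto_average_torus {d : Type*} [Fintype d] (w : d → ℝ)
    (F : C(UnitAddTorus d, ℂ)) :
    ∃ m : ℂ, Tendsto (fun T : ℝ => (T : ℂ)⁻¹ * ∫ t in (0 : ℝ)..T,
      F fun i => ((w i * t : ℝ) : UnitAddCircle)) atTop (𝓝 m) := by
  set orb : ℝ → UnitAddTorus d := fun t i => ((w i * t : ℝ) : UnitAddCircle) with horb
  have horbc : Continuous orb := by
    refine continuous_pi fun i => ?_
    exact (AddCircle.continuous_mk' (1 : ℝ)).comp (by fun_prop)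
  have hFint : ∀ (F : C(UnitAddTorus d, ℂ)) (T : ℝ),
      IntervalIntegrable (fun t => F (orb t)) volume 0 T := fun F T =>
    (F.continuous.comp horbc).intervalIntegrable _ _
  have hchar : ∀ k : d → ℤ, ∃ m : ℂ, Tendsto (fun T : ℝ => (T : ℂ)⁻¹ * ∫ t in (0 : ℝ)..T,
      UnitAddTorus.mFourier k (orb t)) atTop (𝓝 m) := by
    intro k
    set c : ℂ := 2 * Real.pi * Complex.I * ∑ i, (k i : ℂ) * (w i : ℂ) with hc
    have hexp : ∀ t : ℝ, UnitAddTorus.mFourier k (orb t) = Complex.exp (c * t) := by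
      intro t
      simp only [UnitAddTorus.mFourier, ContinuousMap.coe_mk, horb, fourier_coe_apply]
      rw [← Complex.exp_sum]
      congr 1
      rw [hc, Finset.mul_sum, Finset.sum_mul]
      refine Finset.sum_congr rfl fun i _ => ?_
      push_cast
      ring
    simp_rw [hexp]
    rcases eq_or_ne c 0 with h0 | h0
    · refine ⟨1, ?_⟩
      refine tendsto_const_nhds.congr' ?_
      filter_upwards [eventually_gt_atTop 0] with T hT
      have hT' : (T : ℂ) ≠ 0 := by exact_mod_cast hT.ne'
      simp [h0, hT']
    · refine ⟨0, ?_⟩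
      have hre : c.re = 0 := by
        rw [hc]
        have : (∑ i, (k i : ℂ) * (w i : ℂ)) = ((∑ i, (k i : ℝ) * w i : ℝ) : ℂ) := by push_cast; rfl
        rw [this]
        simp
      have hnorm : ∀ T : ℝ, ‖Complex.exp (c * T)‖ = 1 := by
        intro T
        rw [Complex.norm_exp]
        simp [hre]
      have hz : Tendsto (fun T : ℝ => T⁻¹ * (2 / ‖c‖)) atTop (𝓝 0) := by
        simpa using tendsto_inv_atTop_zero.mul_const (2 / ‖c‖)
      refine squeeze_zero_norm' ?_ hz
      filter_upwards [eventually_gt_atTop 0] with T hT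
      rw [integral_exp_mul_complex h0, norm_mul, norm_div, norm_inv, Complex.norm_real,
        Real.norm_eq_abs, abs_of_pos hT]
      gcongr
      refine (norm_sub_le _ _).trans ?_
      rw [hnorm]
      simp
      norm_num
  have hspan : ∀ G ∈ Submodule.span ℂ (Set.range (UnitAddTorus.mFourier (d := d))),
      ∃ m : ℂ, Tendsto (fun T : ℝ => (T : ℂ)⁻¹ * ∫ t in (0 : ℝ)..T, G (orb t)) atTop (𝓝 m) := by
    intro G hG
    induction hG using Submodule.span_induction with
    | mem x hx =>
      obtain ⟨k, rfl⟩ := hx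
      exact hchar k
    | zero => exact ⟨0, by simp⟩
    | add x y _ _ hx hy =>
      obtain ⟨a, ha⟩ := hx
      obtain ⟨b, hb⟩ := hy
      refine ⟨a + b, (ha.add hb).congr fun T => ?_⟩
      simp only [ContinuousMap.add_apply]
      rw [intervalIntegral.integral_add (hFint x T) (hFint y T), mul_add]
    | smul z x _ hx =>
      obtain ⟨a, ha⟩ := hx
      refine ⟨z * a, (ha.const_mul z).congr fun T => ?_⟩
      simp only [ContinuousMap.smul_apply, smul_eq_mul]
      rw [intervalIntegral.integral_const_mul]
      ring
  have hdense : F ∈ closure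
      (Submodule.span ℂ (Set.range (UnitAddTorus.mFourier (d := d))) : Set C(UnitAddTorus d, ℂ)) := by
    rw [← Submodule.topologicalClosure_coe, UnitAddTorus.span_mFourier_closure_eq_top]
    trivial
  refine cauchy_map_iff_exists_tendsto.1 (Metric.cauchy_iff.2 ⟨inferInstance, fun ε hε => ?_⟩)
  obtain ⟨G, hG, hFG⟩ := Metric.mem_closure_iff.1 hdense (ε / 4) (by positivity)
  obtain ⟨m, hm⟩ := hspan G hG
  refine ⟨Metric.ball m (ε / 2), ?_, fun x hx y hy => ?_⟩
  · have h1 := hm.eventually (Metric.ball_mem_nhds m (show 0 < ε / 4 by positivity))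
    change ∀ᶠ T : ℝ in atTop, _ ∈ Metric.ball m (ε / 2)
    filter_upwards [h1, eventually_gt_atTop 0] with T hT hT0
    have h2 : ‖(T : ℂ)⁻¹ * (∫ t in (0 : ℝ)..T, F (orb t))
        - (T : ℂ)⁻¹ * ∫ t in (0 : ℝ)..T, G (orb t)‖ ≤ ε / 4 := by
      rw [← mul_sub, ← intervalIntegral.integral_sub (hFint F T) (hFint G T), norm_mul, norm_inv,
        Complex.norm_real, Real.norm_eq_abs, abs_of_pos hT0]
      have h3 := intervalIntegral.norm_integral_le_of_norm_le_const (a := 0) (b := T) (C := ε / 4)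
        (f := fun t => F (orb t) - G (orb t)) fun t _ => by
          have h4 := (F - G).norm_coe_le_norm (orb t)
          rw [dist_eq_norm] at hFG
          exact h4.trans hFG.le
      rw [sub_zero, abs_of_pos hT0] at h3
      calc T⁻¹ * _ ≤ T⁻¹ * (ε / 4 * T) := by gcongr
        _ = ε / 4 := by field_simp
    rw [Metric.mem_ball]
    rw [← dist_eq_norm] at h2
    exact (dist_triangle _ _ _).trans_lt ((add_lt_add_of_le_of_lt h2 hT).trans_eq (by ring))
  · have h1 := dist_triangle_right x y m
    rw [Metric.mem_ball] at hx hy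
    linarith

variable {H : Type*} [NormedAddCommGroup H] [InnerProductSpace ℂ H] [FiniteDimensional ℂ H]

theorem hasSum_exp_apply (T : H →L[ℂ] H) (v : H) :
    HasSum (fun n : ℕ => ((n ! : ℂ)⁻¹) • (T ^ n) v) (NormedSpace.exp T v) := by
  have : CompleteSpace H := FiniteDimensional.complete ℂ H
  have h := NormedSpace.exp_series_hasSum_exp' (𝕂 := ℂ) T
  have h2 := h.mapL (ContinuousLinearMap.apply ℂ H v)
  simpa only [ContinuousLinearMap.apply_apply, smul_apply] using h2

theorem evolution_apply_of_eigenvector {Ham : H →L[ℂ] H} {v : H} {e : ℂ} (hv : Ham v = e • v)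
    (t : ℝ) :
    QState.evolution Ham t v = Complex.exp (-(Complex.I * t) * e) • v := by
  set z : ℂ := -(Complex.I * t) * e with hz
  have hpow : ∀ n : ℕ, (((-(Complex.I * (t : ℂ))) • Ham) ^ n) v = z ^ n • v := by
    intro n
    induction n with
    | zero => simp
    | succ n ih =>
      rw [pow_succ', mul_apply_eq_comp, ih, map_smul, smul_apply,
        hv, smul_smul, smul_smul, hz]
      congr 1
      ring
  have h1 := hasSum_exp_apply ((-(Complex.I * (t : ℂ))) • Ham) v
  have h2 := (NormedSpace.exp_series_hasSum_exp' (𝕂 := ℂ) z).smul_const v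
  rw [← Complex.exp_eq_exp_ℂ] at h2
  refine h1.unique (h2.congr_fun fun n => ?_)
  rw [hpow, smul_assoc]

theorem evolution_mem {Ham : H →L[ℂ] H} {K : Submodule ℂ H} (hK : ∀ x ∈ K, Ham x ∈ K) (t : ℝ)
    {v : H} (hv : v ∈ K) : QState.evolution Ham t v ∈ K := by
  have hpow : ∀ n : ℕ, (((-(Complex.I * (t : ℂ))) • Ham) ^ n) v ∈ K := by
    intro n
    induction n with
    | zero => simpa using hv
    | succ n ih =>
      rw [pow_succ', mul_apply_eq_comp]
      exact K.smul_mem _ (hK _ ih)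
  refine K.closed_of_finiteDimensional.mem_of_tendsto (hasSum_exp_apply _ v)
    (Eventually.of_forall fun s => K.sum_mem fun n _ => K.smul_mem _ (hpow n))

/-- The evolution in the energy eigenbasis. -/
theorem exists_eigenbasis_evolution {Ham : H →L[ℂ] H} (hH : (Ham : H →ₗ[ℂ] H).IsSymmetric) :
    ∃ (b : OrthonormalBasis (Fin (Module.finrank ℂ H)) ℂ H) (e : Fin (Module.finrank ℂ H) → ℝ),
      ∀ (t : ℝ) (v : H), QState.evolution Ham t v
        = ∑ i, (Complex.exp (-(Complex.I * t) * e i) * ⟪b i, v⟫_ℂ) • b i := by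
  refine ⟨hH.eigenvectorBasis rfl, hH.eigenvalues rfl, fun t v => ?_⟩
  set b := hH.eigenvectorBasis rfl
  conv_lhs => rw [← b.sum_repr' v, map_sum]
  refine Finset.sum_congr rfl fun i _ => ?_
  rw [map_smul, evolution_apply_of_eigenvector (hH.apply_eigenvectorBasis rfl i), smul_smul,
    mul_comm]
  rfl

theorem norm_evolution {Ham : H →L[ℂ] H} (hH : (Ham : H →ₗ[ℂ] H).IsSymmetric) (t : ℝ) (v : H) :
    ‖QState.evolution Ham t v‖ = ‖v‖ := by
  obtain ⟨b, e, h⟩ := exists_eigenbasis_evolution hH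
  have hcoord : ∀ j, ‖⟪b j, QState.evolution Ham t v⟫_ℂ‖ = ‖⟪b j, v⟫_ℂ‖ := by
    intro j
    rw [h, b.orthonormal.inner_right_fintype, norm_mul, Complex.norm_exp]
    simp
  have h1 := b.sum_sq_norm_inner_right (QState.evolution Ham t v)
  rw [Finset.sum_congr rfl fun j _ => by rw [hcoord j], b.sum_sq_norm_inner_right] at h1
  exact ((sq_eq_sq₀ (norm_nonneg _) (norm_nonneg _)).1 h1).symm

theorem continuous_evolution {Ham : H →L[ℂ] H} (hH : (Ham : H →ₗ[ℂ] H).IsSymmetric) :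
    Continuous fun p : ℝ × H => QState.evolution Ham p.1 p.2 := by
  obtain ⟨b, e, h⟩ := exists_eigenbasis_evolution hH
  simp_rw [h]
  fun_prop

/-- The evolution restricted to an invariant subspace, as a unitary map. -/
noncomputable def evolutionOn {Ham : H →L[ℂ] H} (hH : (Ham : H →ₗ[ℂ] H).IsSymmetric)
    {K : Submodule ℂ H} (hK : ∀ x ∈ K, Ham x ∈ K) (t : ℝ) : K ≃ₗᵢ[ℂ] K :=
  LinearIsometry.toLinearIsometryEquiv
    ⟨(QState.evolution Ham t : H →ₗ[ℂ] H).restrict fun _ hx => evolution_mem hK t hx,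
      fun x => norm_evolution hH t x⟩ rfl

/-- The infinite-time average of a continuous function of the evolved vector exists: the orbit is the
image of a one-parameter subgroup of the torus of phases of the energy eigenvectors. -/
theorem tendsto_timeAverage_evolution {Ham : H →L[ℂ] H} (hH : (Ham : H →ₗ[ℂ] H).IsSymmetric)
    {D : H → ℝ} (hD : Continuous D) (v : H) :
    Tendsto (QState.averageUpTo fun t => D (QState.evolution Ham t v)) atTop
      (𝓝 (QState.timeAverage fun t => D (QState.evolution Ham t v))) := by
  obtain ⟨b, e, h⟩ := exists_eigenbasis_evolution hH
  let F : C(UnitAddTorus (Fin (Module.finrank ℂ H)), ℂ) :=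
    ⟨fun z => (D (∑ i, (fourier 1 (z i) * ⟪b i, v⟫_ℂ) • b i) : ℂ), by fun_prop⟩
  obtain ⟨m, hm⟩ := exists_tendsto_average_torus (fun i => -(e i) / (2 * Real.pi)) F
  have horb : ∀ t : ℝ, F (fun i => ((-(e i) / (2 * Real.pi) * t : ℝ) : UnitAddCircle))
      = (D (QState.evolution Ham t v) : ℂ) := by
    intro t
    have hpi : (Real.pi : ℂ) ≠ 0 := by exact_mod_cast Real.pi_ne_zero
    simp only [F, ContinuousMap.coe_mk, h, fourier_coe_apply]
    congr 3
    funext i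
    congr 3
    push_cast
    field_simp
  simp_rw [horb] at hm
  refine tendsto_nhds_limUnder ⟨m.re, ?_⟩
  refine ((Complex.continuous_re.tendsto m).comp hm).congr fun T => ?_
  simp only [Function.comp, QState.averageUpTo]
  rw [intervalIntegral.integral_ofReal, ← Complex.ofReal_inv, ← Complex.ofReal_mul,
    Complex.ofReal_re]

theorem lipschitzOnWith_timeAverage {Ham : H →L[ℂ] H} (hH : (Ham : H →ₗ[ℂ] H).IsSymmetric)
    {D : H → ℝ} (hD : Continuous D) (hL : LipschitzOnWith 1 D (Metric.sphere 0 1)) :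
    LipschitzOnWith 1 (fun v => QState.timeAverage fun t => D (QState.evolution Ham t v))
      (Metric.sphere 0 1) := by
  have hcont : ∀ v, Continuous fun t => D (QState.evolution Ham t v) := fun v =>
    hD.comp ((continuous_evolution hH).comp (by fun_prop : Continuous fun t : ℝ => (t, v)))
  refine LipschitzOnWith.of_dist_le_mul fun x hx y hy => ?_
  have hlim := (tendsto_timeAverage_evolution hH hD x).dist (tendsto_timeAverage_evolution hH hD y)
  refine le_of_tendsto hlim ?_
  filter_upwards [eventually_gt_atTop 0] with T hT
  have hsph : ∀ (t : ℝ) {z : H}, z ∈ Metric.sphere (0 : H) 1 →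
      QState.evolution Ham t z ∈ Metric.sphere (0 : H) 1 := by
    intro t z hz
    simpa [norm_evolution hH] using hz
  have hpt : ∀ t : ℝ, ‖D (QState.evolution Ham t x) - D (QState.evolution Ham t y)‖ ≤ ‖x - y‖ := by
    intro t
    have h := hL.dist_le_mul _ (hsph t hx) _ (hsph t hy)
    rwa [dist_eq_norm, dist_eq_norm, NNReal.coe_one, one_mul, ← map_sub, norm_evolution hH] at h
  have hI := intervalIntegral.norm_integral_le_of_norm_le_const (a := 0) (b := T)
    (f := fun t => D (QState.evolution Ham t x) - D (QState.evolution Ham t y)) fun t _ => hpt t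
  rw [sub_zero, abs_of_pos hT, intervalIntegral.integral_sub ((hcont x).intervalIntegrable _ _)
    ((hcont y).intervalIntegrable _ _)] at hI
  unfold QState.averageUpTo
  rw [dist_eq_norm, dist_eq_norm, ← mul_sub, norm_mul, norm_inv, Real.norm_eq_abs, abs_of_pos hT,
    NNReal.coe_one, one_mul]
  calc T⁻¹ * _ ≤ T⁻¹ * (‖x - y‖ * T) := by gcongr
    _ = ‖x - y‖ := by field_simp

/-- Averaging over time does not change the mean over initial states, since the evolution preserves
the uniform measure. -/
theorem integral_timeAverage [MeasurableSpace H] [BorelSpace H] {Ham : H →L[ℂ] H}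
    (hH : (Ham : H →ₗ[ℂ] H).IsSymmetric) {K : Submodule ℂ H} (hK : ∀ x ∈ K, Ham x ∈ K)
    {σ : Measure (Metric.sphere (0 : K) 1)} [IsProbabilityMeasure σ] (hσ : IsUnitarilyInvariant σ)
    {D : H → ℝ} (hD : Continuous D) :
    ∫ u, QState.timeAverage (fun t => D (QState.evolution Ham t ((u : K) : H))) ∂σ
      = ∫ u, D ((u : K) : H) ∂σ := by
  have : ProperSpace H := FiniteDimensional.proper ℂ H
  obtain ⟨C, hC⟩ := (isCompact_sphere (0 : H) 1).exists_bound_of_continuousOn hD.continuousOn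
  have hbound : ∀ (t : ℝ) (u : Metric.sphere (0 : K) 1),
      ‖D (QState.evolution Ham t ((u : K) : H))‖ ≤ C := by
    intro t u
    refine hC _ ?_
    rw [mem_sphere_zero_iff_norm, norm_evolution hH]
    exact mem_sphere_zero_iff_norm.1 u.2
  have hcont : Continuous fun p : ℝ × Metric.sphere (0 : K) 1 =>
      D (QState.evolution Ham p.1 ((p.2 : K) : H)) :=
    hD.comp ((continuous_evolution hH).comp (by fun_prop :
      Continuous fun p : ℝ × Metric.sphere (0 : K) 1 => (p.1, ((p.2 : K) : H))))
  have hfub : ∀ T : ℝ, 0 < T →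
      ∫ u, QState.averageUpTo (fun t => D (QState.evolution Ham t ((u : K) : H))) T ∂σ
        = ∫ u, D ((u : K) : H) ∂σ := by
    intro T hT
    have hfinite : IsFiniteMeasure (volume.restrict (Set.uIoc (0 : ℝ) T)) :=
      ⟨by simp [Set.uIoc_of_le hT.le]⟩
    have hint : Integrable (Function.uncurry fun (t : ℝ) (u : Metric.sphere (0 : K) 1) =>
        D (QState.evolution Ham t ((u : K) : H))) ((volume.restrict (Set.uIoc 0 T)).prod σ) :=
      (integrable_const C).mono' hcont.aestronglyMeasurable
        (Eventually.of_forall fun p => hbound p.1 p.2)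
    unfold QState.averageUpTo
    rw [integral_const_mul, ← intervalIntegral_integral_swap hint]
    have hinv : ∀ t : ℝ, ∫ u, D (QState.evolution Ham t ((u : K) : H)) ∂σ
        = ∫ u, D ((u : K) : H) ∂σ := fun t => hσ (evolutionOn hH hK t) fun v => D v
    simp_rw [hinv]
    rw [intervalIntegral.integral_const, sub_zero, smul_eq_mul, ← mul_assoc, inv_mul_cancel₀ hT.ne',
      one_mul]
  have hlim : Tendsto
      (fun T => ∫ u, QState.averageUpTo (fun t => D (QState.evolution Ham t ((u : K) : H))) T ∂σ)
      atTop (𝓝 (∫ u, QState.timeAverage (fun t => D (QState.evolution Ham t ((u : K) : H))) ∂σ)) := by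
    refine tendsto_integral_filter_of_dominated_convergence (fun _ => C) ?_ ?_ (integrable_const _)
      (Eventually.of_forall fun u => tendsto_timeAverage_evolution hH hD _)
    · refine Eventually.of_forall fun T => ?_
      unfold QState.averageUpTo
      refine Continuous.aestronglyMeasurable (continuous_const.mul ?_)
      exact intervalIntegral.continuous_parametric_intervalIntegral_of_continuous'
        (f := fun (u : Metric.sphere (0 : K) 1) t => D (QState.evolution Ham t ((u : K) : H)))
        (hcont.comp continuous_swap) 0 T
    · filter_upwards [eventually_gt_atTop 0] with T hT
      refine Eventually.of_forall fun u => ?_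
      have h := intervalIntegral.norm_integral_le_of_norm_le_const (a := 0) (b := T)
        (f := fun t => D (QState.evolution Ham t ((u : K) : H))) fun t _ => hbound t u
      rw [sub_zero, abs_of_pos hT] at h
      unfold QState.averageUpTo
      rw [norm_mul, norm_inv, Real.norm_eq_abs, abs_of_pos hT]
      calc T⁻¹ * _ ≤ T⁻¹ * (C * T) := by gcongr
        _ = C := by field_simp
  refine tendsto_nhds_unique hlim (tendsto_const_nhds.congr' ?_)
  filter_upwards [eventually_gt_atTop 0] with T hT
  exact (hfub T hT).symm

end Evolution

/-! ### The uniform measure on the sphere of a subspace -/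

section UniformSphere

variable {H : Type*} [NormedAddCommGroup H] [InnerProductSpace ℂ H]

/-- The real inner product of a complex subspace, on top of its canonical structure of a real normed
space. -/
@[reducible] noncomputable def Submodule.realInnerProductSpace (K : Submodule ℂ H) :
    InnerProductSpace ℝ K :=
  { (inferInstance : NormedSpace ℝ K) with
    inner := fun x y => (inner ℂ x y).re
    norm_sq_eq_re_inner := (InnerProductSpace.complexToReal (G := K)).norm_sq_eq_re_inner
    conj_inner_symm := (InnerProductSpace.complexToReal (G := K)).conj_inner_symm
    add_left := (InnerProductSpace.complexToReal (G := K)).add_left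
    smul_left := (InnerProductSpace.complexToReal (G := K)).smul_left }

variable [FiniteDimensional ℂ H] [MeasurableSpace H] [BorelSpace H]

theorem QState.uniformSphere_eq (K : Submodule ℂ H) :
    letI := K.realInnerProductSpace
    QState.uniformSphere K = sphereProb (Measure.addHaar : Measure K) := rfl

theorem QState.isProbabilityMeasure_uniformSphere (K : Submodule ℂ H) (hK : K ≠ ⊥) :
    IsProbabilityMeasure (QState.uniformSphere K) := by
  let := K.realInnerProductSpace
  have : Nontrivial K := Submodule.nontrivial_iff_ne_bot.2 hK
  rw [QState.uniformSphere_eq]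
  infer_instance

theorem QState.isUnitarilyInvariant_uniformSphere (K : Submodule ℂ H) (hK : K ≠ ⊥) :
    IsUnitarilyInvariant (QState.uniformSphere K) := by
  let := K.realInnerProductSpace
  have : Nontrivial K := Submodule.nontrivial_iff_ne_bot.2 hK
  intro U g
  rw [QState.uniformSphere_eq]
  let U' : K ≃ₗᵢ[ℝ] K := { U.toLinearEquiv.restrictScalars ℝ with norm_map' := U.norm_map }
  exact integral_sphereProb_isometry _ U' g

/-- Lévy's lemma for a 1-Lipschitz function on the unit sphere of a complex space of dimension `d`,
which is a real sphere in dimension `2 d`. -/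
theorem QState.uniformSphere_levy (K : Submodule ℂ H) (hK : K ≠ ⊥) {f : H → ℝ}
    (hf : LipschitzOnWith 1 f (Metric.sphere 0 1)) {M : ℝ}
    (hM : ∫ u, f ((u : K) : H) ∂QState.uniformSphere K ≤ M) {ε : ℝ} (hε : 0 < ε) :
    QState.uniformSphere K {u | f ((u : K) : H) > ε + M}
      ≤ ENNReal.ofReal
          (Real.exp (-(1 / (18 * Real.pi ^ 3) * ε ^ 2 * (Module.finrank ℂ K : ℝ)))) := by
  let := K.realInnerProductSpace
  have : Nontrivial K := Submodule.nontrivial_iff_ne_bot.2 hK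
  have hfin : Module.finrank ℝ K = 2 * Module.finrank ℂ K := finrank_real_of_complex K
  have hd : 0 < Module.finrank ℂ K := Module.finrank_pos
  have hfK : LipschitzOnWith 1 (fun v : K => f (v : H)) (Metric.sphere 0 1) := by
    refine LipschitzOnWith.of_dist_le_mul fun x hx y hy => ?_
    exact hf.dist_le_mul (x : H) (by simpa using hx) (y : H) (by simpa using hy)
  have h := levy_lemma (Measure.addHaar : Measure K) (by rw [hfin]; omega) hfK hε
  rw [QState.uniformSphere_eq] at hM ⊢
  refine (measure_mono fun u hu => ?_).trans (h.trans (le_of_eq ?_))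
  · have hu' : ε + M < f ((u : K) : H) := hu
    change _ < f ((u : K) : H)
    linarith
  · rw [hfin]
    congr 2
    push_cast
    field_simp
    norm_num

end UniformSphere

/-! ### Typical pure states are indistinguishable from the maximally mixed state -/

theorem theorem1 {H : Type*} [NormedAddCommGroup H] [InnerProductSpace ℂ H]
    [FiniteDimensional ℂ H] [MeasurableSpace H] [BorelSpace H]
    (K : Submodule ℂ H) (hK : K ≠ ⊥)
    (𝒜 : Finset (POVM H)) (h𝒜 : 𝒜.Nonempty) :
    (∀ ε : ℝ, 0 < ε →
      QState.uniformSphere K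
          {ψ | QState.distinguishSet 𝒜 h𝒜 (QState.pureState ((ψ : K) : H)) (QState.maxMixed K) >
            ε + (QState.totalOutcomes 𝒜 : ℝ) / (2 * √(Module.finrank ℂ K : ℝ))}
        ≤ ENNReal.ofReal
            (Real.exp (-(1 / (18 * Real.pi ^ 3) * ε ^ 2 * (Module.finrank ℂ K : ℝ))))) ∧
    (∀ Ham : H →L[ℂ] H, (Ham : H →ₗ[ℂ] H).IsSymmetric → (∀ x ∈ K, Ham x ∈ K) →
      (∀ ψ : Metric.sphere (0 : K) 1,
        Tendsto
          (QState.averageUpTo fun t => QState.distinguishSet 𝒜 h𝒜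
            (QState.pureState (QState.evolution Ham t ((ψ : K) : H))) (QState.maxMixed K))
          atTop
          (𝓝 (QState.timeAverage fun t => QState.distinguishSet 𝒜 h𝒜
            (QState.pureState (QState.evolution Ham t ((ψ : K) : H))) (QState.maxMixed K)))) ∧
      (∀ ε : ℝ, 0 < ε →
        QState.uniformSphere K
            {ψ | (QState.timeAverage fun t => QState.distinguishSet 𝒜 h𝒜
                (QState.pureState (QState.evolution Ham t ((ψ : K) : H))) (QState.maxMixed K)) >
              ε + (QState.totalOutcomes 𝒜 : ℝ) / (2 * √(Module.finrank ℂ K : ℝ))}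
          ≤ ENNReal.ofReal
              (Real.exp (-(1 / (18 * Real.pi ^ 3) * ε ^ 2 * (Module.finrank ℂ K : ℝ)))))) := by
  have := QState.isProbabilityMeasure_uniformSphere K hK
  have hσ := QState.isUnitarilyInvariant_uniformSphere K hK
  have hL := QState.lipschitzOnWith_distinguishSet 𝒜 h𝒜 (QState.maxMixed K)
  have hD := QState.continuous_distinguishSet 𝒜 h𝒜 (QState.maxMixed K)
  have hM := QState.integral_distinguishSet_le K hK hσ 𝒜 h𝒜
  refine ⟨fun ε hε => QState.uniformSphere_levy K hK hL hM hε, fun Ham hH hinv =>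
    ⟨fun ψ => tendsto_timeAverage_evolution hH hD _, fun ε hε => ?_⟩⟩
  exact QState.uniformSphere_levy K hK (lipschitzOnWith_timeAverage hH hD hL)
    ((integral_timeAverage hH hinv hσ hD).trans_le hM) hε
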